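/- Let $\mathcal H=\ell^2(\mathbb Z)$ (complex) with canonical basis $(e_i)_{i\in\mathbb Z}$. Let $T$ be a bounded selfadjoint operator on $\mathcal H\otimes\mathcal H$ with $T\ge -I$ that satisfies the Yang–Baxter equation $T_1T_2T_1=T_2T_1T_2$ on $\mathcal H^{\otimes 3}$ (where $T_1=T\otimes I$, $T_2=I\otimes T$) and the Hecke relation $T^2=(q-1)T+qI$ for some real $q\ge -1$. On $\mathcal H^{\otimes n}$ let $T_k$ be $T$ acting on the $k$-th and $(k+1)$-th tensor factors, let $$R^{(n)}=I+T_1+T_1T_2+\dots+T_1T_2\cdots T_{n-1},\qquad P^{(0)}=I,\quad P^{(n+1)}=(I\otimes P^{(n)})R^{(n+1)}\quad(n\ge 0).$$ The operators $P^{(n)}$ are positive; let $\mathcal H^n_T$ be the Hilbert space obtained from $\mathcal H^{\otimes n}$ with the pre-inner product $\langle \xi,\eta\rangle_T=\langle \xi,P^{(n)}\eta\rangle$ by dividing out the kernel and completing, let $\mathcal F_T(\mathcal H)=\bigoplus_{n\ge 0}\mathcal H^n_T$ be the $T$-deformed Fock space, and let $\Omega=(1,0,0,\dots)$ be its vacuum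 vector. Suppose that 1. $M_T:=\sup_{n\ge 1}\|R^{(n)}\|<\infty$. Then, for $f\in\mathcal H$, the creator $a^\dagger(f)\xi=f\otimes\xi$ defines a bounded operator on $\mathcal F_T(\mathcal H)$; its adjoint is the annihilator $a(f)$, and $a_i:=a(e_i)$. Let $\mathfrak R_T$ be the unital $C^*$-algebra of operators on $\mathcal F_T(\mathcal H)$ generated by $\{a_i\mid i\in\mathbb Z\}$. 2. $T$ commutes with $U\otimes U$, where $U$ is the unitary shift $Ue_i=e_{i+1}$. Then $U^{\otimes n}$, $n\ge0$, induce a unitary $\mathcal F_T(U)$ of $\mathcal F_T(\mathcal H)$, and $\alpha(X)=\mathcal F_T(U)X\mathcal F_T(U)^*$ is an automorphism of $\mathfrak R_T$ with $\alpha(a_i)=a_{i+1}$. 3. The sum in the commutation rule $a_ia_j^\dagger-\sum_{k,l\in\mathbb Z}t_{jl}^{ik}a_k^\dagger a_l=\delta_{ij}I$ is finite, i.e. for all $i,j\in\mathbb Z$ only finitely many pairs $(k,l)$ have $t_{jl}^{ik}\ne0$, where $T(e_i\otimes e_j)=\sum_{k,l}t_{ij}^{kl}\,e_k\otimes e_l$.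 Then the $C^*$-dynamical system $(\mathfrak R_T,\alpha)$ is uniquely mixing with the Fock vacuum state $\omega(X)=\langle\Omega,X\Omega\rangle$: for every $X\in\mathfrak R_T$ and every bounded linear functional $f$ on $\mathfrak R_T$, $$\lim_{n\to+\infty}f(\alpha^n(X))=f(I)\,\omega(X),$$ and $\omega$ is the unique $\alpha$-invariant state on $\mathfrak R_T$. -/

import Mathlib

open scoped InnerProductSpace ENNReal

noncomputable section

namespace DeformedFock

/-- The complex Hilbert space `ℓ²(X)`. -/
abbrev L2 (X : Type) : Type := lp (fun _ : X => ℂ) 2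

section Tensor

variable {X Y Z : Type}

theorem summable_sq (ξ : L2 X) : Summable fun x => ‖ξ x‖ ^ 2 := by
  have := (lp.memℓp ξ).summable (by norm_num)
  simpa using this

theorem norm_sq_eq (ξ : L2 X) : ‖ξ‖ ^ 2 = ∑' x, ‖ξ x‖ ^ 2 := by
  have := lp.norm_rpow_eq_tsum (p := 2) (by norm_num) ξ
  simpa using this

theorem memℓp_two {f : X → ℂ} (h : Summable fun x => ‖f x‖ ^ 2) : Memℓp f 2 :=
  memℓp_gen (by simpa using h)

/-- For an identification `e` of `X` with `Z × Y`, hence of `ℓ²(X)` with `ℓ²(Z) ⊗ ℓ²(Y)`, the slice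
of `ξ ∈ ℓ²(X)` at `z : Z` is the vector `y ↦ ξ (z, y)` of `ℓ²(Y)`. -/
def slice (e : X ≃ Z × Y) (z : Z) (ξ : L2 X) : L2 Y :=
  ⟨fun y => ξ (e.symm (z, y)), memℓp_two <|
    (summable_sq ξ).comp_injective (i := fun y => e.symm (z, y)) fun a b h => by simpa using h⟩

@[simp] theorem slice_apply (e : X ≃ Z × Y) (z : Z) (ξ : L2 X) (y : Y) :
    slice e z ξ y = ξ (e.symm (z, y)) := rfl

theorem slice_add (e : X ≃ Z × Y) (z : Z) (ξ η : L2 X) :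
    slice e z (ξ + η) = slice e z ξ + slice e z η := rfl

theorem slice_smul (e : X ≃ Z × Y) (z : Z) (c : ℂ) (ξ : L2 X) :
    slice e z (c • ξ) = c • slice e z ξ := rfl

theorem slice_ext (e : X ≃ Z × Y) {ξ η : L2 X} (h : ∀ z, slice e z ξ = slice e z η) : ξ = η := by
  apply lp.ext
  funext x
  have := congrArg (fun ζ : L2 Y => ζ (e x).2) (h (e x).1)
  simpa using this

theorem hasSum_slice_inner (e : X ≃ Z × Y) (ξ η : L2 X) :
    HasSum (fun z => ⟪slice e z ξ, slice e z η⟫_ℂ) ⟪ξ, η⟫_ℂ := by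
  have h := (e.symm.hasSum_iff (f := fun x => ⟪ξ x, η x⟫_ℂ)).2 (lp.hasSum_inner ξ η)
  exact h.prod_fiberwise fun z => lp.hasSum_inner (slice e z ξ) (slice e z η)

theorem hasSum_slice_norm (e : X ≃ Z × Y) (ξ : L2 X) :
    HasSum (fun z => ‖slice e z ξ‖ ^ 2) (‖ξ‖ ^ 2) := by
  have h := hasSum_slice_inner e ξ ξ
  simp only [inner_self_eq_norm_sq_to_K] at h
  exact_mod_cast h

theorem memℓp_amplify (e : X ≃ Z × Y) (A : L2 Y →L[ℂ] L2 Y) (ξ : L2 X) :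
    Memℓp (fun x => A (slice e (e x).1 ξ) (e x).2) 2 := by
  apply memℓp_two
  rw [← e.symm.summable_iff]
  rw [summable_prod_of_nonneg (fun _ => by simp)]
  constructor
  · intro z
    simpa using summable_sq (A (slice e z ξ))
  · have : ∀ z, ∑' y, ((fun x => ‖A (slice e (e x).1 ξ) (e x).2‖ ^ 2) ∘ e.symm) (z, y)
        = ‖A (slice e z ξ)‖ ^ 2 := by
      intro z
      rw [norm_sq_eq]
      simp
    simp only [this]
    refine Summable.of_nonneg_of_le (fun _ => by positivity) (fun z => ?_)
      ((hasSum_slice_norm e ξ).summable.mul_left (‖A‖ ^ 2))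
    rw [← mul_pow]
    gcongr
    exact A.le_opNorm _

/-- For an identification `e` of `ℓ²(X)` with `ℓ²(Z) ⊗ ℓ²(Y)`, the operator on `ℓ²(X)` given by
`I ⊗ A` for a bounded operator `A` on `ℓ²(Y)`: it applies `A` to every slice. -/
def amplify (e : X ≃ Z × Y) (A : L2 Y →L[ℂ] L2 Y) : L2 X →L[ℂ] L2 X :=
  LinearMap.mkContinuous
    { toFun := fun ξ => ⟨fun x => A (slice e (e x).1 ξ) (e x).2, memℓp_amplify e A ξ⟩
      map_add' := fun ξ η => by
        apply lp.ext
        funext x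
        simp only [slice_add, map_add]
        rfl
      map_smul' := fun c ξ => by
        apply lp.ext
        funext x
        simp [slice_smul] } ‖A‖ (fun ξ => by
    set η : L2 X := ⟨fun x => A (slice e (e x).1 ξ) (e x).2, memℓp_amplify e A ξ⟩ with hη
    have hs : ∀ z, slice e z η = A (slice e z ξ) := by
      intro z
      apply lp.ext
      funext y
      simp [hη]
    change ‖η‖ ≤ _
    refine le_of_sq_le_sq ?_ (by positivity)
    rw [mul_pow]
    refine hasSum_le (fun z => ?_) (hasSum_slice_norm e η)
      ((hasSum_slice_norm e ξ).mul_left (‖A‖ ^ 2))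
    rw [hs, ← mul_pow]
    gcongr
    exact A.le_opNorm _)

theorem amplify_apply (e : X ≃ Z × Y) (A : L2 Y →L[ℂ] L2 Y) (ξ : L2 X) (x : X) :
    amplify e A ξ x = A (slice e (e x).1 ξ) (e x).2 := rfl

theorem slice_amplify (e : X ≃ Z × Y) (A : L2 Y →L[ℂ] L2 Y) (z : Z) (ξ : L2 X) :
    slice e z (amplify e A ξ) = A (slice e z ξ) := by
  apply lp.ext
  funext y
  simp [amplify_apply]

theorem amplify_one (e : X ≃ Z × Y) : amplify e 1 = 1 := by
  ext1 ξ
  exact slice_ext e fun z => by simp [slice_amplify]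

theorem amplify_zero (e : X ≃ Z × Y) : amplify e 0 = 0 := by
  ext1 ξ
  exact slice_ext e fun z => by rw [slice_amplify]; rfl

theorem amplify_mul (e : X ≃ Z × Y) (A B : L2 Y →L[ℂ] L2 Y) :
    amplify e (A * B) = amplify e A * amplify e B := by
  ext1 ξ
  exact slice_ext e fun z => by simp [slice_amplify]

theorem amplify_add (e : X ≃ Z × Y) (A B : L2 Y →L[ℂ] L2 Y) :
    amplify e (A + B) = amplify e A + amplify e B := by
  ext1 ξ
  exact slice_ext e fun z => by simp [slice_amplify, slice_add]

theorem amplify_smul (e : X ≃ Z × Y) (c : ℂ) (A : L2 Y →L[ℂ] L2 Y) :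
    amplify e (c • A) = c • amplify e A := by
  ext1 ξ
  exact slice_ext e fun z => by simp [slice_amplify, slice_smul]

theorem inner_amplify_left (e : X ≃ Z × Y) (A : L2 Y →L[ℂ] L2 Y) (hA : IsSelfAdjoint A)
    (ξ η : L2 X) : ⟪amplify e A ξ, η⟫_ℂ = ⟪ξ, amplify e A η⟫_ℂ := by
  have h1 := hasSum_slice_inner e (amplify e A ξ) η
  have h2 := hasSum_slice_inner e ξ (amplify e A η)
  simp only [slice_amplify] at h1 h2
  have : (fun z => ⟪A (slice e z ξ), slice e z η⟫_ℂ) = fun z => ⟪slice e z ξ, A (slice e z η)⟫_ℂ := by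
    funext z
    exact hA.isSymmetric _ _
  rw [this] at h1
  exact h1.unique h2

theorem amplify_isSelfAdjoint (e : X ≃ Z × Y) {A : L2 Y →L[ℂ] L2 Y} (hA : IsSelfAdjoint A) :
    IsSelfAdjoint (amplify e A) := by
  rw [ContinuousLinearMap.isSelfAdjoint_iff_isSymmetric]
  exact fun ξ η => inner_amplify_left e A hA ξ η

/-- Two bounded operators on `ℓ²(X)` with the same matrix elements are equal. -/
theorem ext_single [DecidableEq X] {A B : L2 X →L[ℂ] L2 X}
    (h : ∀ x x', A (lp.single 2 x (1 : ℂ)) x' = B (lp.single 2 x (1 : ℂ)) x') : A = B := by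
  apply lp.ext_continuousLinearMap (𝕜 := ℂ) (by norm_num)
  intro x
  ext1
  apply lp.ext
  funext x'
  simpa using h x x'

theorem slice_single [DecidableEq X] [DecidableEq Y] [DecidableEq Z] (e : X ≃ Z × Y) (z : Z)
    (x : X) : slice e z (lp.single 2 x (1 : ℂ))
      = if z = (e x).1 then lp.single 2 (e x).2 (1 : ℂ) else 0 := by
  apply lp.ext
  funext y
  by_cases hz : z = (e x).1
  · by_cases hy : y = (e x).2
    · subst hz hy
      simp
    · rw [if_pos hz, slice_apply, lp.single_apply_ne _ _ _ hy, lp.single_apply_ne]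
      rintro rfl
      simp at hy
  · rw [if_neg hz, slice_apply, lp.single_apply_ne]
    · rfl
    · rintro rfl
      simp at hz

theorem amplify_single [DecidableEq X] [DecidableEq Y] [DecidableEq Z] (e : X ≃ Z × Y)
    (A : L2 Y →L[ℂ] L2 Y) (x x' : X) : amplify e A (lp.single 2 x (1 : ℂ)) x'
      = if (e x').1 = (e x).1 then A (lp.single 2 (e x).2 (1 : ℂ)) (e x').2 else 0 := by
  rw [amplify_apply, slice_single]
  split_ifs <;> simp

theorem amplify_amplify_single [DecidableEq X] [DecidableEq Y] [DecidableEq Z] (e : X ≃ Z × Y)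
    (A : L2 Y →L[ℂ] L2 Y) (B : L2 Z →L[ℂ] L2 Z) (x x' : X) :
    amplify e A (amplify (e.trans (Equiv.prodComm Z Y)) B (lp.single 2 x (1 : ℂ))) x'
      = B (lp.single 2 (e x).1 (1 : ℂ)) (e x').1 * A (lp.single 2 (e x).2 (1 : ℂ)) (e x').2 := by
  have : slice e (e x').1 (amplify (e.trans (Equiv.prodComm Z Y)) B (lp.single 2 x (1 : ℂ)))
      = B (lp.single 2 (e x).1 (1 : ℂ)) (e x').1 • lp.single 2 (e x).2 (1 : ℂ) := by
    apply lp.ext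
    funext y
    rw [slice_apply, amplify_single]
    by_cases hy : y = (e x).2
    · simp [hy]
    · simp [hy]
  rw [amplify_apply, this]
  simp

/-- `I ⊗ A` and `B ⊗ I` commute. -/
theorem amplify_commute (e : X ≃ Z × Y) (A : L2 Y →L[ℂ] L2 Y) (B : L2 Z →L[ℂ] L2 Z) :
    Commute (amplify e A) (amplify (e.trans (Equiv.prodComm Z Y)) B) := by
  classical
  apply ext_single
  intro x x'
  have h := amplify_amplify_single (e.trans (Equiv.prodComm Z Y)) B A x x'
  have he : (e.trans (Equiv.prodComm Z Y)).trans (Equiv.prodComm Y Z) = e := by ext <;> rfl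
  rw [he] at h
  simp only [mul_apply_eq_comp]
  rw [amplify_amplify_single, h, mul_comm]
  rfl

theorem memℓp_tensorVec (e : X ≃ Z × Y) (f : L2 Z) (ξ : L2 Y) :
    Memℓp (fun x => f (e x).1 * ξ (e x).2) 2 := by
  apply memℓp_two
  rw [← e.symm.summable_iff]
  have := (summable_sq f).mul_of_nonneg (summable_sq ξ) (fun _ => by positivity)
    (fun _ => by positivity)
  refine this.congr fun p => ?_
  simp [mul_pow]

/-- The elementary tensor `f ⊗ ξ`, as a linear function of `ξ`. -/
def tensorVec (e : X ≃ Z × Y) (f : L2 Z) : L2 Y →ₗ[ℂ] L2 X where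
  toFun ξ := ⟨fun x => f (e x).1 * ξ (e x).2, memℓp_tensorVec e f ξ⟩
  map_add' ξ η := by
    apply lp.ext
    funext x
    exact mul_add _ _ _
  map_smul' c ξ := by
    apply lp.ext
    funext x
    simp [mul_left_comm]

theorem tensorVec_apply (e : X ≃ Z × Y) (f : L2 Z) (ξ : L2 Y) (x : X) :
    tensorVec e f ξ x = f (e x).1 * ξ (e x).2 := rfl

theorem slice_tensorVec (e : X ≃ Z × Y) (f : L2 Z) (ξ : L2 Y) (z : Z) :
    slice e z (tensorVec e f ξ) = f z • ξ := by
  apply lp.ext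
  funext y
  simp [tensorVec_apply]

theorem amplify_tensorVec (e : X ≃ Z × Y) (A : L2 Y →L[ℂ] L2 Y) (f : L2 Z) (ξ : L2 Y) :
    amplify e A (tensorVec e f ξ) = tensorVec e f (A ξ) :=
  slice_ext e fun z => by simp [slice_amplify, slice_tensorVec]

theorem inner_tensorVec (e : X ≃ Z × Y) (f : L2 Z) (ξ η : L2 Y) :
    ⟪tensorVec e f ξ, tensorVec e f η⟫_ℂ = ((‖f‖ ^ 2 : ℝ) : ℂ) * ⟪ξ, η⟫_ℂ := by
  have h1 := hasSum_slice_inner e (tensorVec e f ξ) (tensorVec e f η)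
  have h2 := (Complex.hasSum_ofReal.2 ((summable_sq f).hasSum)).mul_right ⟪ξ, η⟫_ℂ
  rw [← norm_sq_eq] at h2
  have h3 : (fun z => ⟪slice e z (tensorVec e f ξ), slice e z (tensorVec e f η)⟫_ℂ)
      = fun z => ((‖f z‖ ^ 2 : ℝ) : ℂ) * ⟪ξ, η⟫_ℂ := by
    funext z
    rw [slice_tensorVec, slice_tensorVec, inner_smul_left, inner_smul_right, ← mul_assoc,
      RCLike.conj_mul]
    norm_cast
  rw [h3] at h1
  exact h1.unique h2

/-- The unitary of `ℓ²(X)` that sends the basis vector at `x` to the basis vector at `σ x`. -/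
def permute (σ : X ≃ X) : L2 X ≃ₗᵢ[ℂ] L2 X where
  toFun ξ := ⟨fun x => ξ (σ.symm x), memℓp_two ((summable_sq ξ).comp_injective σ.symm.injective)⟩
  invFun ξ := ⟨fun x => ξ (σ x), memℓp_two ((summable_sq ξ).comp_injective σ.injective)⟩
  map_add' ξ η := rfl
  map_smul' c ξ := rfl
  left_inv ξ := by
    apply lp.ext
    funext x
    simp
  right_inv ξ := by
    apply lp.ext
    funext x
    simp
  norm_map' ξ := by
    refine (sq_eq_sq₀ (norm_nonneg _) (norm_nonneg _)).1 ?_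
    rw [norm_sq_eq, norm_sq_eq, ← σ.symm.tsum_eq (fun x => ‖ξ x‖ ^ 2)]
    rfl

theorem permute_apply (σ : X ≃ X) (ξ : L2 X) (x : X) : permute σ ξ x = ξ (σ.symm x) := rfl

end Tensor

/-- The `n`-fold Hilbert tensor power of `ℋ = ℓ²(ℤ)`, realized as `ℓ²(ℤⁿ)`: the basis vector at
`(i₁, …, iₙ)` is `e_{i₁} ⊗ ⋯ ⊗ e_{iₙ}`. -/
abbrev TensorPower (n : ℕ) : Type := L2 (Fin n → ℤ)

/-- Bounded operators on the `n`-fold tensor power. -/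
abbrev Op (n : ℕ) : Type := TensorPower n →L[ℂ] TensorPower n

/-- The identification of `ℤⁿ⁺¹` with `ℤ × ℤⁿ` that splits off the first coordinate. -/
def headTail (n : ℕ) : (Fin (n + 1) → ℤ) ≃ ℤ × (Fin n → ℤ) :=
  (Fin.consEquiv fun _ => ℤ).symm

/-- The identification of `ℤⁿ⁺²` with `ℤⁿ × ℤ²` that splits off the first two coordinates
(which become the second component). -/
def headTwo (n : ℕ) : (Fin (n + 2) → ℤ) ≃ (Fin n → ℤ) × (Fin 2 → ℤ) where
  toFun x := (fun i => x i.succ.succ, ![x 0, x 1])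
  invFun p := Fin.cons (p.2 0) (Fin.cons (p.2 1) p.1)
  left_inv x := by
    funext i
    refine Fin.cases rfl (fun i => Fin.cases rfl (fun i => rfl) i) i
  right_inv p := by
    refine Prod.ext ?_ ?_
    · rfl
    · funext i
      fin_cases i <;> rfl

/-- The identification of `ℤⁿ⁺³` with `ℤⁿ × ℤ³` that splits off the first three coordinates. -/
def headThree (n : ℕ) : (Fin (n + 3) → ℤ) ≃ (Fin n → ℤ) × (Fin 3 → ℤ) where
  toFun x := (fun i => x i.succ.succ.succ, ![x 0, x 1, x 2])
  invFun p := Fin.cons (p.2 0) (Fin.cons (p.2 1) (Fin.cons (p.2 2) p.1))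
  left_inv x := by
    funext i
    refine Fin.cases rfl (fun i => Fin.cases rfl (fun i => Fin.cases rfl (fun i => rfl) i) i) i
  right_inv p := by
    refine Prod.ext ?_ ?_
    · rfl
    · funext i
      fin_cases i <;> rfl

/-- `I ⊗ A` on the `(n+1)`-fold tensor power. -/
def idTensor {n : ℕ} (A : Op n) : Op (n + 1) := amplify (headTail n) A

/-- `T ⊗ I ⊗ ⋯ ⊗ I` on the `(n+2)`-fold tensor power, for `T` acting on `ℋ ⊗ ℋ`. -/
def tensorId (T : Op 2) (n : ℕ) : Op (n + 2) := amplify (headTwo n) T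

/-- The operator `I ⊗ ⋯ ⊗ I ⊗ T ⊗ I ⊗ ⋯ ⊗ I` on the `n`-fold tensor power in which `T` acts on the
factors number `k` and `k + 1`, the factors being numbered from `0` (so this is `T_{k+1}` in the
numbering from `1`). It is meaningful for `k + 2 ≤ n`; other values of `k` are never used. -/
def leg (T : Op 2) : (n k : ℕ) → Op n
  | n + 2, 0 => tensorId T n
  | n + 1, k + 1 => idTensor (leg T n k)
  | 0, _ => 0
  | 1, 0 => 0

/-- `R⁽ⁿ⁾ = I + T₁ + T₁T₂ + ⋯ + T₁T₂⋯Tₙ₋₁`. -/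
def R (T : Op 2) (n : ℕ) : Op n :=
  ∑ m ∈ Finset.range n, ((List.range m).map (leg T n)).prod

/-- The `T`-symmetrizer: `P⁽⁰⁾ = I` and `P⁽ⁿ⁺¹⁾ = (I ⊗ P⁽ⁿ⁾) R⁽ⁿ⁺¹⁾`; in particular `P⁽¹⁾ = I` and
`P⁽²⁾ = I + T`. -/
def P (T : Op 2) : (n : ℕ) → Op n
  | 0 => 1
  | n + 1 => idTensor (P T n) * R T (n + 1)

/-- Selfadjoint Yang–Baxter–Hecke operators on `ℋ ⊗ ℋ`, `ℋ = ℓ²(ℤ)`. -/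
structure IsYangBaxterHecke (T : Op 2) : Prop where
  isSelfAdjoint : IsSelfAdjoint T
  neg_one_le : -1 ≤ T
  yangBaxter : leg T 3 0 * leg T 3 1 * leg T 3 0 = leg T 3 1 * leg T 3 0 * leg T 3 1
  hecke : ∃ q : ℝ, -1 ≤ q ∧ T * T = ((q - 1 : ℝ) : ℂ) • T + (q : ℂ) • (1 : Op 2)

section Symmetrizer

variable {T : Op 2}

theorem idTensor_one (n : ℕ) : idTensor (1 : Op n) = 1 := amplify_one _
theorem idTensor_mul {n : ℕ} (A B : Op n) : idTensor (A * B) = idTensor A * idTensor B :=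
  amplify_mul _ A B
theorem idTensor_smul {n : ℕ} (c : ℂ) (A : Op n) : idTensor (c • A) = c • idTensor A :=
  amplify_smul _ c A
theorem idTensor_isSelfAdjoint {n : ℕ} {A : Op n} (hA : IsSelfAdjoint A) :
    IsSelfAdjoint (idTensor A) := amplify_isSelfAdjoint _ hA

/-- `A ↦ I ⊗ A` as a ring homomorphism. -/
def idTensorHom (n : ℕ) : Op n →+* Op (n + 1) where
  toFun := idTensor
  map_one' := idTensor_one n
  map_mul' := idTensor_mul
  map_zero' := amplify_zero _
  map_add' := amplify_add _

theorem leg_succ (T : Op 2) (n k : ℕ) : leg T (n + 1) (k + 1) = idTensor (leg T n k) := by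
  cases n <;> rfl

theorem R_succ (T : Op 2) (n : ℕ) :
    R T (n + 1) = 1 + leg T (n + 1) 0 * idTensor (R T n) := by
  have h := Finset.sum_range_succ' (fun m => ((List.range m).map (leg T (n + 1))).prod) n
  refine h.trans ((add_comm _ _).trans ?_)
  congr 1
  change _ = _ * idTensorHom n (∑ m ∈ Finset.range n, _)
  rw [map_sum, Finset.mul_sum]
  refine Finset.sum_congr rfl fun m _ => ?_
  rw [List.range_succ_eq_map, List.map_cons, List.prod_cons, map_list_prod, List.map_map,
    List.map_map]
  congr 3
  funext k
  exact leg_succ T n k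

theorem idTensor_idTensor {n : ℕ} (A : Op n) : idTensor (idTensor A)
    = amplify ((headTwo n).trans (Equiv.prodComm _ _)) A := by
  ext1 ξ
  apply lp.ext
  funext x
  rfl

theorem tensorId_commute {n : ℕ} (T : Op 2) (A : Op n) :
    Commute (tensorId T n) (idTensor (idTensor A)) := by
  rw [idTensor_idTensor]
  exact amplify_commute (headTwo n) T A

theorem leg_three_zero (T : Op 2) (n : ℕ) :
    tensorId T (n + 1) = amplify (headThree n) (leg T 3 0) := by
  ext1 ξ
  apply lp.ext
  funext x
  have h : slice (headTwo (n + 1)) (headTwo (n + 1) x).1 ξ = slice (headTwo 1)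
      (headTwo 1 (headThree n x).2).1 (slice (headThree n) (headThree n x).1 ξ) := by
    apply lp.ext
    funext y
    refine congrArg ξ (funext fun i => ?_)
    refine Fin.cases rfl (fun i => Fin.cases rfl (fun i => Fin.cases rfl (fun i => rfl) i) i) i
  exact congrArg (fun ζ : TensorPower 2 => T ζ ![x 0, x 1]) h

theorem leg_three_one (T : Op 2) (n : ℕ) :
    idTensor (tensorId T n) = amplify (headThree n) (leg T 3 1) := by
  ext1 ξ
  apply lp.ext
  funext x
  rfl

theorem tensorId_braid (hT : IsYangBaxterHecke T) (n : ℕ) :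
    tensorId T (n + 1) * idTensor (tensorId T n) * tensorId T (n + 1)
      = idTensor (tensorId T n) * tensorId T (n + 1) * idTensor (tensorId T n) := by
  rw [leg_three_zero, leg_three_one, ← amplify_mul, ← amplify_mul, ← amplify_mul, ← amplify_mul,
    hT.yangBaxter]

theorem tensorId_hecke {q : ℝ} (hq : T * T = ((q - 1 : ℝ) : ℂ) • T + (q : ℂ) • (1 : Op 2)) (n : ℕ) :
    tensorId T n * tensorId T n = ((q - 1 : ℝ) : ℂ) • tensorId T n + (q : ℂ) • (1 : Op (n + 2)) := by
  rw [tensorId, ← amplify_mul, hq, amplify_add, amplify_smul, amplify_smul, amplify_one]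

theorem tensorId_R_aux {S : Type*} [Ring S] [Algebra ℂ S] {q : ℝ} {a b A B : S}
    (h1 : a * a = ((q - 1 : ℝ) : ℂ) • a + (q : ℂ) • (1 : S)) (h2 : a * b * a = b * a * b)
    (h3 : a * B = B * a) (h4 : A = 1 + b * B) (h5 : b * (B * A) = (q : ℂ) • (B * A)) :
    a * (A * (1 + a * A)) = (q : ℂ) • (A * (1 + a * A)) := by
  have e1 : A * (a * A) = a * A + b * a * (B * A) := by
    conv_lhs => rw [h4]
    conv_rhs => rw [h4]
    have : b * B * a = b * a * B := by rw [mul_assoc, ← h3, mul_assoc]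
    rw [add_mul, one_mul, ← mul_assoc (b * B), this]
    simp only [mul_assoc]
  have e2 : a * (b * a * (B * A)) = (q : ℂ) • (b * a * (B * A)) := by
    rw [← mul_assoc a, ← mul_assoc a b a, h2, mul_assoc (b * a), h5, mul_smul_comm]
  have e3 : a * (a * A) = ((q - 1 : ℝ) : ℂ) • (a * A) + (q : ℂ) • A := by
    rw [← mul_assoc, h1, add_mul, smul_mul_assoc, smul_mul_assoc, one_mul]
  rw [mul_add, mul_one, e1, mul_add, mul_add, e2, e3]
  push_cast
  module

theorem tensorId_R {q : ℝ} (hT : IsYangBaxterHecke T)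
    (hq : T * T = ((q - 1 : ℝ) : ℂ) • T + (q : ℂ) • (1 : Op 2)) (n : ℕ) :
    tensorId T n * (idTensor (R T (n + 1)) * R T (n + 2))
      = (q : ℂ) • (idTensor (R T (n + 1)) * R T (n + 2)) := by
  induction n with
  | zero =>
    have h1 : R T 1 = 1 := by
      rw [R_succ]
      change 1 + 0 * _ = (1 : Op 1)
      rw [zero_mul, add_zero]
    have h2 : R T 2 = 1 + tensorId T 0 := by
      rw [R_succ, h1, idTensor_one, mul_one]
      rfl
    change _ * (idTensor (R T 1) * R T 2) = _ • (idTensor (R T 1) * R T 2)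
    rw [h1, h2, idTensor_one, one_mul, mul_add, mul_one, tensorId_hecke hq]
    push_cast
    module
  | succ n ih =>
    have h := congrArg idTensor ih
    rw [idTensor_mul, idTensor_smul, idTensor_mul] at h
    rw [R_succ T (n + 2)]
    change _ * (_ * (1 + tensorId T (n + 1) * _)) = _ • (_ * (1 + tensorId T (n + 1) * _))
    refine tensorId_R_aux (b := idTensor (tensorId T n))
      (B := idTensor (idTensor (R T (n + 1)))) (tensorId_hecke hq _) (tensorId_braid hT n)
      (tensorId_commute T _) ?_ h
    rw [R_succ T (n + 1)]
    change idTensorHom _ (1 + _) = _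
    rw [map_add, map_one, map_mul]
    rfl

theorem leg_mul_P {q : ℝ} (hT : IsYangBaxterHecke T)
    (hq : T * T = ((q - 1 : ℝ) : ℂ) • T + (q : ℂ) • (1 : Op 2)) :
    ∀ n k : ℕ, k + 1 < n → leg T n k * P T n = (q : ℂ) • P T n
  | 0, k, h => by omega
  | 1, k, h => by omega
  | n + 2, 0, _ => by
    change tensorId T n * (idTensor (idTensor (P T n) * R T (n + 1)) * R T (n + 2))
      = _ • (idTensor (idTensor (P T n) * R T (n + 1)) * R T (n + 2))
    rw [idTensor_mul, mul_assoc, ← mul_assoc, (tensorId_commute T (P T n)).eq, mul_assoc,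
      tensorId_R hT hq, mul_smul_comm]
  | n + 2, k + 1, h => by
    change idTensor (leg T (n + 1) k) * (idTensor (P T (n + 1)) * R T (n + 2))
      = _ • (idTensor (P T (n + 1)) * R T (n + 2))
    rw [← mul_assoc, ← idTensor_mul, leg_mul_P hT hq (n + 1) k (by omega), idTensor_smul,
      smul_mul_assoc]

theorem P_isSelfAdjoint (hT : IsYangBaxterHecke T) : ∀ n : ℕ, IsSelfAdjoint (P T n)
  | 0 => IsSelfAdjoint.one _
  | 1 => by
    have : P T 1 = 1 := by
      change idTensor 1 * R T 1 = (1 : Op 1)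
      rw [R_succ, idTensor_one]
      change 1 * (1 + 0 * _) = (1 : Op 1)
      simp
    rw [this]
    exact IsSelfAdjoint.one _
  | n + 2 => by
    have h1 := idTensor_isSelfAdjoint (P_isSelfAdjoint hT (n + 1))
    have h2 := idTensor_isSelfAdjoint (idTensor_isSelfAdjoint (P_isSelfAdjoint hT n))
    have h3 : idTensor (P T (n + 1)) = idTensor (idTensor (P T n)) * idTensor (R T (n + 1)) :=
      idTensor_mul _ _
    have h4 : IsSelfAdjoint (tensorId T n) := amplify_isSelfAdjoint _ hT.isSelfAdjoint
    have h5 := (tensorId_commute T (P T n)).eq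
    have h6 : P T (n + 2) = idTensor (P T (n + 1))
        + idTensor (P T (n + 1)) * (tensorId T n * idTensor (R T (n + 1))) := by
      change _ * R T (n + 2) = _
      rw [R_succ, mul_add, mul_one]
      rfl
    rw [h6]
    refine h1.add ?_
    have h7 : idTensor (P T (n + 1))
        = star (idTensor (R T (n + 1))) * idTensor (idTensor (P T n)) := by
      rw [← h1.star_eq, h3, star_mul, h2.star_eq]
    rw [isSelfAdjoint_iff, star_mul, star_mul, h1.star_eq, h4.star_eq]
    conv_lhs => rw [h3]
    conv_rhs => rw [h7]
    simp only [mul_assoc]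
    rw [← mul_assoc (tensorId T n), h5]
    simp only [mul_assoc]

/-- The `q`-factorial. -/
def qFact (q : ℝ) : ℕ → ℝ
  | 0 => 1
  | n + 1 => (∑ i ∈ Finset.range (n + 1), q ^ i) * qFact q n

theorem qFact_nonneg {q : ℝ} (hq : -1 ≤ q) : ∀ n, 0 ≤ qFact q n
  | 0 => zero_le_one
  | n + 1 => by
    refine mul_nonneg ?_ (qFact_nonneg hq n)
    rcases Nat.even_or_odd (n + 1) with h | h
    · obtain ⟨m, hm⟩ := h
      rw [hm, ← two_mul]
      have : ∀ k, 0 ≤ ∑ i ∈ Finset.range (2 * k), q ^ i := by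
        intro k
        induction k with
        | zero => simp
        | succ k ih =>
          rw [mul_add, mul_one, Finset.sum_range_succ, Finset.sum_range_succ, pow_succ, pow_mul]
          have : 0 ≤ (q ^ 2) ^ k * (1 + q) := mul_nonneg (by positivity) (by linarith)
          linarith
      exact this m
    · exact (h.geom_sum_pos).le

theorem R_mul_P {q : ℝ} (hT : IsYangBaxterHecke T)
    (hq : T * T = ((q - 1 : ℝ) : ℂ) • T + (q : ℂ) • (1 : Op 2)) (n : ℕ) :
    R T n * P T n = ((∑ i ∈ Finset.range n, q ^ i : ℝ) : ℂ) • P T n := by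
  rw [R, Finset.sum_mul]
  push_cast
  rw [Finset.sum_smul]
  refine Finset.sum_congr rfl fun m hm => ?_
  rw [Finset.mem_range] at hm
  induction m with
  | zero => simp
  | succ m ih =>
    rw [List.range_succ, List.map_append, List.prod_append, List.map_singleton,
      List.prod_singleton, mul_assoc, leg_mul_P hT hq n m hm, mul_smul_comm, ih (by omega),
      smul_smul, pow_succ']

theorem P_sq {q : ℝ} (hT : IsYangBaxterHecke T)
    (hq : T * T = ((q - 1 : ℝ) : ℂ) • T + (q : ℂ) • (1 : Op 2)) :
    ∀ n : ℕ, P T n * P T n = (qFact q n : ℂ) • P T n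
  | 0 => by
    change (1 : Op 0) * 1 = ((1 : ℝ) : ℂ) • (1 : Op 0)
    simp
  | n + 1 => by
    have h := P_sq hT hq n
    have h1 : idTensor (P T n) * P T (n + 1) = (qFact q n : ℂ) • P T (n + 1) := by
      change idTensor (P T n) * (idTensor (P T n) * _) = _ • (idTensor (P T n) * _)
      rw [← mul_assoc, ← idTensor_mul, h, idTensor_smul, smul_mul_assoc]
    calc P T (n + 1) * P T (n + 1) = idTensor (P T n) * (R T (n + 1) * P T (n + 1)) :=
          mul_assoc _ _ _
      _ = _ := by
        rw [R_mul_P hT hq, mul_smul_comm, h1, smul_smul, qFact]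
        push_cast
        rfl

theorem eq_zero_of_sq {n : ℕ} {A : Op n} (hA : IsSelfAdjoint A) (h : A * A = 0) : A = 0 := by
  rw [← CStarRing.star_mul_self_eq_zero_iff, hA.star_eq, h]

/-- The `T`-symmetrizers are positive. -/
theorem P_isPositive (hT : IsYangBaxterHecke T) (n : ℕ) : (P T n).IsPositive := by
  obtain ⟨q, hq1, hq⟩ := hT.hecke
  have hs := P_isSelfAdjoint hT n
  have h := P_sq hT hq n
  rcases (qFact_nonneg hq1 n).eq_or_lt with h0 | h0
  · rw [← h0, Complex.ofReal_zero, zero_smul] at h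
    rw [eq_zero_of_sq hs h]
    exact ContinuousLinearMap.isPositive_zero
  · have h2 : P T n = (((qFact q n)⁻¹ : ℝ) : ℂ) • (star (P T n) * P T n) := by
      rw [hs.star_eq, h, smul_smul, ← Complex.ofReal_mul, inv_mul_cancel₀ h0.ne',
        Complex.ofReal_one, one_smul]
    rw [h2]
    refine (ContinuousLinearMap.isPositive_adjoint_comp_self (P T n)).smul_of_nonneg ?_
    exact_mod_cast (inv_nonneg.2 h0.le)

/-- `P⁽ⁿ⁺¹⁾ ≤ ‖R⁽ⁿ⁺¹⁾‖ (I ⊗ P⁽ⁿ⁾)` as quadratic forms. -/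
theorem inner_P_succ_le (hT : IsYangBaxterHecke T) (n : ℕ) (ξ : TensorPower (n + 1)) :
    (⟪ξ, P T (n + 1) ξ⟫_ℂ).re ≤ ‖R T (n + 1)‖ * (⟪ξ, idTensor (P T n) ξ⟫_ℂ).re := by
  obtain ⟨q, hq1, hq⟩ := hT.hecke
  have hs := P_isSelfAdjoint hT (n + 1)
  have hs' := idTensor_isSelfAdjoint (P_isSelfAdjoint hT n)
  set Q := idTensor (P T n) with hQ
  have hQQ : Q * Q = (qFact q n : ℂ) • Q := by
    rw [hQ, ← idTensor_mul, P_sq hT hq n, idTensor_smul]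
  have hP : P T (n + 1) = Q * R T (n + 1) := rfl
  rcases (qFact_nonneg hq1 n).eq_or_lt with h0 | h0
  · rw [← h0, Complex.ofReal_zero, zero_smul] at hQQ
    have : Q = 0 := eq_zero_of_sq hs' hQQ
    rw [hP, this]
    simp
  · have hQP : Q * P T (n + 1) = (qFact q n : ℂ) • P T (n + 1) := by
      rw [hP, ← mul_assoc, hQQ, smul_mul_assoc]
    have hPQ : P T (n + 1) * Q = (qFact q n : ℂ) • P T (n + 1) := by
      have := congrArg star hQP
      rw [star_mul, hs.star_eq, hs'.star_eq, star_smul, hs.star_eq] at this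
      simpa using this
    have key : (qFact q n : ℂ) • P T (n + 1) = Q * R T (n + 1) * Q := by
      rw [← hPQ, hP]
    have hin : (qFact q n) * (⟪ξ, P T (n + 1) ξ⟫_ℂ).re = (⟪Q ξ, R T (n + 1) (Q ξ)⟫_ℂ).re := by
      have h1 : ⟪ξ, (Q * R T (n + 1) * Q) ξ⟫_ℂ = ⟪Q ξ, R T (n + 1) (Q ξ)⟫_ℂ :=
        (hs'.isSymmetric ξ (R T (n + 1) (Q ξ))).symm
      rw [← h1, ← key, smul_apply, inner_smul_right, Complex.re_ofReal_mul]
    have hn : ‖Q ξ‖ ^ 2 = qFact q n * (⟪ξ, Q ξ⟫_ℂ).re := by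
      have h1 : ⟪Q ξ, Q ξ⟫_ℂ = ⟪ξ, (Q * Q) ξ⟫_ℂ := hs'.isSymmetric ξ (Q ξ)
      rw [hQQ] at h1
      have h2 := congrArg Complex.re h1
      rw [smul_apply, inner_smul_right, Complex.re_ofReal_mul] at h2
      rw [← h2]
      exact (inner_self_eq_norm_sq (𝕜 := ℂ) (Q ξ)).symm
    refine le_of_mul_le_mul_left ?_ h0
    rw [hin]
    calc (⟪Q ξ, R T (n + 1) (Q ξ)⟫_ℂ).re ≤ ‖Q ξ‖ * ‖R T (n + 1) (Q ξ)‖ :=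
          re_inner_le_norm (𝕜 := ℂ) _ _
      _ ≤ ‖Q ξ‖ * (‖R T (n + 1)‖ * ‖Q ξ‖) := by gcongr; exact ContinuousLinearMap.le_opNorm _ _
      _ = ‖R T (n + 1)‖ * ‖Q ξ‖ ^ 2 := by ring
      _ = _ := by rw [hn]; ring

end Symmetrizer

section Fock

variable {T : Op 2}

/-- The tensor power `ℋ^{⊗n}`, to be equipped with the `T`-deformed pre-inner product
`⟨ξ, P⁽ⁿ⁾ η⟩`. -/
def DeformedPower (_hT : IsYangBaxterHecke T) (n : ℕ) : Type := TensorPower n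

instance (hT : IsYangBaxterHecke T) (n : ℕ) : AddCommGroup (DeformedPower hT n) :=
  inferInstanceAs (AddCommGroup (TensorPower n))

instance (hT : IsYangBaxterHecke T) (n : ℕ) : Module ℂ (DeformedPower hT n) :=
  inferInstanceAs (Module ℂ (TensorPower n))

/-- The identity map from `ℋ^{⊗n}` to the same space with the deformed pre-inner product. -/
def toDeformed (hT : IsYangBaxterHecke T) (n : ℕ) : TensorPower n ≃ₗ[ℂ] DeformedPower hT n :=
  LinearEquiv.refl ℂ _

/-- The `T`-deformed pre-inner product `⟨ξ, η⟩_T = ⟨ξ, P⁽ⁿ⁾ η⟩` on `ℋ^{⊗n}`. -/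
abbrev deformedCore (hT : IsYangBaxterHecke T) (n : ℕ) :
    PreInnerProductSpace.Core ℂ (DeformedPower hT n) where
  inner ξ η := ⟪(toDeformed hT n).symm ξ, P T n ((toDeformed hT n).symm η)⟫_ℂ
  conj_inner_symm ξ η := by
    rw [inner_conj_symm]
    exact (P_isSelfAdjoint hT n).isSymmetric _ _
  re_inner_nonneg ξ := (P_isPositive hT n).re_inner_nonneg_right _
  add_left _ _ _ := by rw [map_add, inner_add_left]
  smul_left _ _ _ := by rw [map_smul, inner_smul_left]

instance (hT : IsYangBaxterHecke T) (n : ℕ) : SeminormedAddCommGroup (DeformedPower hT n) :=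
  InnerProductSpace.Core.toSeminormedAddCommGroup (c := deformedCore hT n)

instance (hT : IsYangBaxterHecke T) (n : ℕ) : InnerProductSpace ℂ (DeformedPower hT n) :=
  InnerProductSpace.ofCore (deformedCore hT n)

theorem deformed_inner (hT : IsYangBaxterHecke T) (n : ℕ) (ξ η : TensorPower n) :
    ⟪toDeformed hT n ξ, toDeformed hT n η⟫_ℂ = ⟪ξ, P T n η⟫_ℂ := rfl

theorem deformed_norm_sq (hT : IsYangBaxterHecke T) (n : ℕ) (ξ : TensorPower n) :
    ‖toDeformed hT n ξ‖ ^ 2 = (⟪ξ, P T n ξ⟫_ℂ).re := by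
  rw [← deformed_inner hT]
  exact (inner_self_eq_norm_sq (𝕜 := ℂ) _).symm

/-- The `n`-particle space: the Hausdorff completion of `ℋ^{⊗n}` with respect to the `T`-deformed
pre-inner product, i.e. the completion of the quotient by the kernel of the latter. -/
abbrev ParticleSpace (hT : IsYangBaxterHecke T) (n : ℕ) : Type :=
  UniformSpace.Completion (DeformedPower hT n)

/-- The `T`-deformed Fock space: the Hilbert space direct sum of the `n`-particle spaces. -/
abbrev FockSpace (hT : IsYangBaxterHecke T) : Type :=
  lp (fun n => ParticleSpace hT n) 2

/-- The `T`-deformed Fock space contains the class of every vector of `ℋ^{⊗n}`. -/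
def toFock (hT : IsYangBaxterHecke T) (n : ℕ) (ξ : TensorPower n) : FockSpace hT :=
  lp.single 2 n (toDeformed hT n ξ : ParticleSpace hT n)

/-- The vacuum vector `Ω = (1, 0, 0, …)`. -/
def vacuum (hT : IsYangBaxterHecke T) : FockSpace hT :=
  toFock hT 0 (lp.single 2 (fun i => i.elim0) 1)

section Generic

variable {E : ℕ → Type} [∀ n, NormedAddCommGroup (E n)]

theorem summable_sq' (ξ : lp E 2) : Summable fun n => ‖ξ n‖ ^ 2 := by
  have := (lp.memℓp ξ).summable (by norm_num)
  simpa using this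

theorem norm_sq_eq' (ξ : lp E 2) : ‖ξ‖ ^ 2 = ∑' n, ‖ξ n‖ ^ 2 := by
  have := lp.norm_rpow_eq_tsum (p := 2) (by norm_num) ξ
  simpa using this

variable [∀ n, InnerProductSpace ℂ (E n)]

/-- The sequence `(0, c₀ ξ₀, c₁ ξ₁, …)`. -/
def raiseFun (c : ∀ n, E n →L[ℂ] E (n + 1)) (ξ : ∀ n, E n) : ∀ n, E n
  | 0 => 0
  | n + 1 => c n (ξ n)

theorem raiseFun_memℓp (c : ∀ n, E n →L[ℂ] E (n + 1)) {C : ℝ} (hc : ∀ n, ‖c n‖ ≤ C)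
    (ξ : lp E 2) : Memℓp (raiseFun c ξ) 2 := by
  apply memℓp_gen
  rw [← summable_nat_add_iff 1]
  refine Summable.of_nonneg_of_le (fun n => by positivity) (fun n => ?_)
    ((summable_sq' ξ).mul_left (C ^ 2))
  simp only [ENNReal.toReal_ofNat, Real.rpow_ofNat, raiseFun]
  rw [← mul_pow]
  gcongr
  exact ((c n).le_opNorm _).trans (by gcongr; exact hc n)

/-- The bounded operator `(ξ₀, ξ₁, …) ↦ (0, c₀ ξ₀, c₁ ξ₁, …)` on a Hilbert space direct sum, for a
uniformly bounded sequence of operators `cₙ`. -/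
def raise (c : ∀ n, E n →L[ℂ] E (n + 1)) (hc : ∃ C : ℝ, ∀ n, ‖c n‖ ≤ C) : lp E 2 →L[ℂ] lp E 2 :=
  LinearMap.mkContinuousOfExistsBound
    { toFun := fun ξ => ⟨raiseFun c ξ, raiseFun_memℓp c hc.choose_spec ξ⟩
      map_add' := fun ξ η => by
        apply lp.ext
        funext n
        cases n with
        | zero => exact (add_zero _).symm
        | succ n => exact (c n).map_add _ _
      map_smul' := fun a ξ => by
        apply lp.ext
        funext n
        cases n with
        | zero => exact (smul_zero _).symm
        | succ n => exact (c n).map_smul _ _ } <| by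
    obtain ⟨C, hC⟩ := hc
    have hC0 : 0 ≤ C := (norm_nonneg _).trans (hC 0)
    refine ⟨C, fun ξ => ?_⟩
    set η : lp E 2 := ⟨raiseFun c ξ, raiseFun_memℓp c hC ξ⟩ with hη
    change ‖η‖ ≤ _
    refine le_of_sq_le_sq ?_ (by positivity)
    rw [mul_pow, norm_sq_eq', norm_sq_eq', (summable_sq' η).tsum_eq_zero_add, ← tsum_mul_left]
    have h0 : ‖η 0‖ ^ 2 = 0 := by
      change ‖(0 : E 0)‖ ^ 2 = 0
      simp
    rw [h0, zero_add]
    refine Summable.tsum_le_tsum (fun n => ?_) ((summable_nat_add_iff 1).2 (summable_sq' η))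
      ((summable_sq' ξ).mul_left _)
    change ‖c n (ξ n)‖ ^ 2 ≤ _
    rw [← mul_pow]
    gcongr
    exact ((c n).le_opNorm _).trans (by gcongr; exact hC n)

theorem raise_apply_zero (c : ∀ n, E n →L[ℂ] E (n + 1)) (hc : ∃ C : ℝ, ∀ n, ‖c n‖ ≤ C)
    (ξ : lp E 2) : raise c hc ξ 0 = 0 := rfl

theorem raise_apply_succ (c : ∀ n, E n →L[ℂ] E (n + 1)) (hc : ∃ C : ℝ, ∀ n, ‖c n‖ ≤ C)
    (ξ : lp E 2) (n : ℕ) : raise c hc ξ (n + 1) = c n (ξ n) := rfl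

/-- The direct sum of a sequence of unitaries. -/
def sumUnitary (u : ∀ n, E n ≃ₗᵢ[ℂ] E n) : lp E 2 ≃ₗᵢ[ℂ] lp E 2 where
  toFun ξ := ⟨fun n => u n (ξ n), memℓp_gen (by
    simpa using summable_sq' ξ)⟩
  invFun ξ := ⟨fun n => (u n).symm (ξ n), memℓp_gen (by
    simpa using summable_sq' ξ)⟩
  map_add' ξ η := by
    apply lp.ext
    funext n
    exact (u n).map_add _ _
  map_smul' c ξ := by
    apply lp.ext
    funext n
    exact (u n).map_smul _ _
  left_inv ξ := by
    apply lp.ext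
    funext n
    simp
  right_inv ξ := by
    apply lp.ext
    funext n
    simp
  norm_map' ξ := by
    refine (sq_eq_sq₀ (norm_nonneg _) (norm_nonneg _)).1 ?_
    rw [norm_sq_eq', norm_sq_eq']
    refine tsum_congr fun n => ?_
    change ‖u n (ξ n)‖ ^ 2 = _
    rw [LinearIsometryEquiv.norm_map]

theorem sumUnitary_apply (u : ∀ n, E n ≃ₗᵢ[ℂ] E n) (ξ : lp E 2) (n : ℕ) :
    sumUnitary u ξ n = u n (ξ n) := rfl

/-- The extension of a unitary to the Hausdorff completion. -/
def completeUnitary {V : Type} [SeminormedAddCommGroup V] [InnerProductSpace ℂ V] (u : V ≃ₗᵢ[ℂ] V) :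
    UniformSpace.Completion V ≃ₗᵢ[ℂ] UniformSpace.Completion V where
  toLinearEquiv := LinearEquiv.ofLinearMap
    (u.toContinuousLinearEquiv : V →L[ℂ] V).completion.toLinearMap
    (u.symm.toContinuousLinearEquiv : V →L[ℂ] V).completion.toLinearMap
    (by
      ext x
      induction x using UniformSpace.Completion.induction_on with
      | hp => exact isClosed_eq (by simp; fun_prop) continuous_id
      | ih x => simp)
    (by
      ext x
      induction x using UniformSpace.Completion.induction_on with
      | hp => exact isClosed_eq (by simp; fun_prop) continuous_id
      | ih x => simp)
  norm_map' x := by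
    induction x using UniformSpace.Completion.induction_on with
    | hp => exact isClosed_eq (by simp; fun_prop) (by fun_prop)
    | ih x => simp

@[simp] theorem completeUnitary_coe {V : Type} [SeminormedAddCommGroup V] [InnerProductSpace ℂ V]
    (u : V ≃ₗᵢ[ℂ] V) (x : V) :
    completeUnitary u (x : UniformSpace.Completion V) = (u x : V) := by
  change (u.toContinuousLinearEquiv : V →L[ℂ] V).completion x = _
  simp

end Generic

/-- The map `ξ ↦ f ⊗ ξ` from `ℋ^{⊗n}` to `ℋ^{⊗(n+1)}`, for the deformed pre-inner products. -/
def creationPower (hT : IsYangBaxterHecke T) (f : L2 ℤ) (n : ℕ) :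
    DeformedPower hT n →L[ℂ] DeformedPower hT (n + 1) :=
  ((toDeformed hT (n + 1)).toLinearMap ∘ₗ tensorVec (headTail n) f ∘ₗ
    (toDeformed hT n).symm.toLinearMap).mkContinuous (√‖R T (n + 1)‖ * ‖f‖) fun x => by
    obtain ⟨ξ, rfl⟩ := (toDeformed hT n).surjective x
    refine le_of_sq_le_sq ?_ (by positivity)
    rw [mul_pow, mul_pow, Real.sq_sqrt (norm_nonneg _), deformed_norm_sq]
    change ‖toDeformed hT (n + 1) (tensorVec (headTail n) f ξ)‖ ^ 2 ≤ _
    rw [deformed_norm_sq]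
    refine (inner_P_succ_le hT n _).trans ?_
    rw [idTensor, amplify_tensorVec, inner_tensorVec, Complex.re_ofReal_mul, mul_assoc]

/-- The creator of `f` from the `n`-particle space to the `(n+1)`-particle space. -/
def creationParticle (hT : IsYangBaxterHecke T) (f : L2 ℤ) (n : ℕ) :
    ParticleSpace hT n →L[ℂ] ParticleSpace hT (n + 1) :=
  (creationPower hT f n).completion

theorem creationParticle_coe (hT : IsYangBaxterHecke T) (f : L2 ℤ) (n : ℕ) (ξ : TensorPower n) :
    creationParticle hT f n (toDeformed hT n ξ : ParticleSpace hT n)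
      = (toDeformed hT (n + 1) (tensorVec (headTail n) f ξ) : ParticleSpace hT (n + 1)) :=
  (creationPower hT f n).completion_apply_coe _

theorem creationParticle_bound (hT : IsYangBaxterHecke T)
    (hM : BddAbove (Set.range fun n => ‖R T n‖)) (f : L2 ℤ) :
    ∃ C : ℝ, ∀ n, ‖creationParticle hT f n‖ ≤ C := by
  obtain ⟨M, hM⟩ := hM
  refine ⟨√M * ‖f‖, fun n => ContinuousLinearMap.opNorm_le_bound _ (by positivity) fun x => ?_⟩
  induction x using UniformSpace.Completion.induction_on with
  | hp => exact isClosed_le (by fun_prop) (by fun_prop)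
  | ih x =>
    rw [creationParticle, ContinuousLinearMap.completion_apply_coe,
      UniformSpace.Completion.norm_coe, UniformSpace.Completion.norm_coe]
    refine ((creationPower hT f n).le_of_opNorm_le
      (LinearMap.mkContinuous_norm_le _ (by positivity) _) x).trans ?_
    gcongr
    exact hM ⟨n + 1, rfl⟩

/-- The creator `a†(f)` on the `T`-deformed Fock space, the bounded operator with
`a†(f) ξ = f ⊗ ξ`. -/
def creation (hT : IsYangBaxterHecke T) (hM : BddAbove (Set.range fun n => ‖R T n‖)) (f : L2 ℤ) :
    FockSpace hT →L[ℂ] FockSpace hT :=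
  raise (creationParticle hT f) (creationParticle_bound hT hM f)

/-- The annihilator `a(f)`, the adjoint of the creator `a†(f)`. -/
def annihilation (hT : IsYangBaxterHecke T) (hM : BddAbove (Set.range fun n => ‖R T n‖))
    (f : L2 ℤ) : FockSpace hT →L[ℂ] FockSpace hT :=
  ContinuousLinearMap.adjoint (creation hT hM f)

theorem creation_toFock (hT : IsYangBaxterHecke T) (hM : BddAbove (Set.range fun n => ‖R T n‖))
    (f : L2 ℤ) (n : ℕ) (ξ : TensorPower n) :
    creation hT hM f (toFock hT n ξ) = toFock hT (n + 1) (tensorVec (headTail n) f ξ) := by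
  apply lp.ext
  funext m
  cases m with
  | zero =>
    have h : toFock hT (n + 1) (tensorVec (headTail n) f ξ) 0 = 0 :=
      lp.single_apply_ne _ _ _ (by omega)
    rw [h]
    rfl
  | succ m =>
    rw [creation, raise_apply_succ]
    by_cases h : m = n
    · subst h
      rw [toFock, toFock, lp.single_apply_self, lp.single_apply_self, creationParticle_coe]
    · rw [toFock, toFock, lp.single_apply_ne _ _ _ h, lp.single_apply_ne _ _ _ (by omega), map_zero]

/-- The canonical basis vector `e_j` of `ℓ²(ℤ)`. -/
def basisVec (j : ℤ) : L2 ℤ := lp.single 2 j (1 : ℂ)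

/-- The unital C⋆-algebra generated by the annihilators `a_j = a(e_j)`, `j ∈ ℤ`, on the
`T`-deformed Fock space: the norm closure of the unital `*`-algebra that they generate. -/
def fockAlgebra (hT : IsYangBaxterHecke T) (hM : BddAbove (Set.range fun n => ‖R T n‖)) :
    StarSubalgebra ℂ (FockSpace hT →L[ℂ] FockSpace hT) :=
  (StarAlgebra.adjoin ℂ (Set.range fun j => annihilation hT hM (basisVec j))).topologicalClosure

/-- The permutation `(i₁, …, iₙ) ↦ (i₁ + 1, …, iₙ + 1)` of `ℤⁿ`. -/
def shiftIndex (n : ℕ) : (Fin n → ℤ) ≃ (Fin n → ℤ) :=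
  Equiv.piCongrRight fun _ => Equiv.addRight (1 : ℤ)

/-- The right shift `U` on `ℓ²(ℤ)`, the unitary with `U e_i = e_{i+1}`. -/
def shift : L2 ℤ ≃ₗᵢ[ℂ] L2 ℤ := permute (Equiv.addRight (1 : ℤ))

/-- The unitary `U ⊗ ⋯ ⊗ U` on the `n`-fold tensor power, where `U` is the right shift: it sends
`e_{i₁} ⊗ ⋯ ⊗ e_{iₙ}` to `e_{i₁+1} ⊗ ⋯ ⊗ e_{iₙ+1}`. -/
def shiftPower (n : ℕ) : TensorPower n ≃ₗᵢ[ℂ] TensorPower n := permute (shiftIndex n)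

/-- `shiftPower n` as a bounded operator. -/
def shiftOp (n : ℕ) : Op n := (shiftPower n).toContinuousLinearEquiv

theorem amplify_permute {X Y Z : Type} (e : X ≃ Z × Y) (σ : X ≃ X) (τ : Y ≃ Y) (ρ : Z ≃ Z)
    (h : ∀ x, e (σ x) = (ρ (e x).1, τ (e x).2)) (A : L2 Y →L[ℂ] L2 Y)
    (hA : ∀ ξ, A (permute τ ξ) = permute τ (A ξ)) (ξ : L2 X) :
    amplify e A (permute σ ξ) = permute σ (amplify e A ξ) := by
  have hs : ∀ z (η : L2 X), slice e z (permute σ η) = permute τ (slice e (ρ.symm z) η) := by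
    intro z η
    apply lp.ext
    funext y
    have hx : σ.symm (e.symm (z, y)) = e.symm (ρ.symm z, τ.symm y) := by
      rw [Equiv.symm_apply_eq]
      apply e.injective
      simp [h]
    exact congrArg η hx
  refine slice_ext e fun z => ?_
  rw [slice_amplify, hs, hA, hs, slice_amplify]

theorem idTensor_shift {n : ℕ} {A : Op n} (hA : Commute A (shiftOp n)) :
    Commute (idTensor A) (shiftOp (n + 1)) := by
  ext1 ξ
  exact amplify_permute (headTail n) (shiftIndex (n + 1)) (shiftIndex n) (Equiv.addRight (1 : ℤ))
    (fun x => rfl) A (fun ξ => congrArg (fun B : Op n => B ξ) hA.eq) ξ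

theorem tensorId_shift (hU : Commute T (shiftOp 2)) (n : ℕ) :
    Commute (tensorId T n) (shiftOp (n + 2)) := by
  ext1 ξ
  refine amplify_permute (headTwo n) (shiftIndex (n + 2)) (shiftIndex 2) (shiftIndex n)
    (fun x => ?_) T (fun ξ => congrArg (fun B : Op 2 => B ξ) hU.eq) ξ
  refine Prod.ext rfl ?_
  funext i
  fin_cases i <;> rfl

theorem R_shift (hU : Commute T (shiftOp 2)) : ∀ n, Commute (R T n) (shiftOp n)
  | 0 => by
    change Commute (0 : Op 0) _
    exact Commute.zero_left _
  | n + 1 => by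
    rw [R_succ]
    refine (Commute.one_left _).add_left (Commute.mul_left ?_ (idTensor_shift (R_shift hU n)))
    cases n with
    | zero => exact Commute.zero_left _
    | succ n => exact tensorId_shift hU n

theorem P_shift (hU : Commute T (shiftOp 2)) : ∀ n, Commute (P T n) (shiftOp n)
  | 0 => Commute.one_left _
  | n + 1 => (idTensor_shift (P_shift hU n)).mul_left (R_shift hU (n + 1))

/-- `U ⊗ ⋯ ⊗ U` as a unitary for the deformed pre-inner product. -/
def shiftDeformed (hT : IsYangBaxterHecke T) (hU : Commute T (shiftOp 2)) (n : ℕ) :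
    DeformedPower hT n ≃ₗᵢ[ℂ] DeformedPower hT n where
  toLinearEquiv := (toDeformed hT n).symm ≪≫ₗ (shiftPower n).toLinearEquiv ≪≫ₗ toDeformed hT n
  norm_map' x := by
    obtain ⟨ξ, rfl⟩ := (toDeformed hT n).surjective x
    refine (sq_eq_sq₀ (norm_nonneg _) (norm_nonneg _)).1 ?_
    change ‖toDeformed hT n (shiftPower n ξ)‖ ^ 2 = _
    rw [deformed_norm_sq, deformed_norm_sq]
    have h : P T n (shiftPower n ξ) = shiftPower n (P T n ξ) :=
      congrArg (fun B : Op n => B ξ) (P_shift hU n).eq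
    rw [h, LinearIsometryEquiv.inner_map_map]

/-- The second quantization of the shift: the unitary of the `T`-deformed Fock space that acts as
`U ⊗ ⋯ ⊗ U` on the `n`-particle space and fixes the vacuum. -/
def fockShift (hT : IsYangBaxterHecke T) (hU : Commute T (shiftOp 2)) :
    FockSpace hT ≃ₗᵢ[ℂ] FockSpace hT :=
  sumUnitary fun n => completeUnitary (shiftDeformed hT hU n)

theorem shiftPower_tensorVec (n : ℕ) (f : L2 ℤ) (ξ : TensorPower n) :
    shiftPower (n + 1) (tensorVec (headTail n) f ξ)
      = tensorVec (headTail n) (shift f) (shiftPower n ξ) := by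
  apply lp.ext
  funext x
  rfl

theorem fockShift_creation (hT : IsYangBaxterHecke T) (hU : Commute T (shiftOp 2))
    (hM : BddAbove (Set.range fun n => ‖R T n‖)) (f : L2 ℤ) (ξ : FockSpace hT) :
    fockShift hT hU (creation hT hM f ξ) = creation hT hM (shift f) (fockShift hT hU ξ) := by
  apply lp.ext
  funext m
  cases m with
  | zero => exact map_zero _
  | succ m =>
    change completeUnitary (shiftDeformed hT hU (m + 1)) (creationParticle hT f m (ξ m))
      = creationParticle hT (shift f) m (completeUnitary (shiftDeformed hT hU m) (ξ m))
    generalize ξ m = x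
    induction x using UniformSpace.Completion.induction_on with
    | hp => exact isClosed_eq (by fun_prop) (by fun_prop)
    | ih x =>
      obtain ⟨ξ, rfl⟩ := (toDeformed hT m).surjective x
      rw [creationParticle_coe, completeUnitary_coe, completeUnitary_coe]
      change ((toDeformed hT (m + 1) (shiftPower (m + 1) (tensorVec (headTail m) f ξ)) :
        DeformedPower hT (m + 1)) : ParticleSpace hT (m + 1)) = creationParticle hT (shift f) m
        ((toDeformed hT m (shiftPower m ξ) : DeformedPower hT m) : ParticleSpace hT m)
      rw [creationParticle_coe, shiftPower_tensorVec]

theorem shift_basisVec (j : ℤ) : shift (basisVec j) = basisVec (j + 1) := by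
  apply lp.ext
  funext i
  change basisVec j (i - 1) = _
  by_cases h : i = j + 1
  · subst h
    simp [basisVec]
  · rw [basisVec, basisVec, lp.single_apply_ne _ _ _ h, lp.single_apply_ne]
    omega

section Conjugation

variable {V : Type} [NormedAddCommGroup V] [InnerProductSpace ℂ V] [CompleteSpace V]

theorem conj_adjoint (u : V ≃ₗᵢ[ℂ] V) (X : V →L[ℂ] V) :
    u.conjStarAlgEquiv (ContinuousLinearMap.adjoint X)
      = ContinuousLinearMap.adjoint (u.conjStarAlgEquiv X) :=
  map_star u.conjStarAlgEquiv X

theorem conj_continuous (u : V ≃ₗᵢ[ℂ] V) : Continuous u.conjStarAlgEquiv := by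
  have : Continuous fun X : V →L[ℂ] V => (u.toContinuousLinearEquiv : V →L[ℂ] V) ∘L X ∘L
      (u.symm.toContinuousLinearEquiv : V →L[ℂ] V) := by fun_prop
  exact this

theorem conj_mem_closure (u : V ≃ₗᵢ[ℂ] V) (s : Set (V →L[ℂ] V))
    (hs : ∀ X ∈ s, u.conjStarAlgEquiv X ∈ s) {X : V →L[ℂ] V}
    (hX : X ∈ (StarAlgebra.adjoin ℂ s).topologicalClosure) :
    u.conjStarAlgEquiv X ∈ (StarAlgebra.adjoin ℂ s).topologicalClosure := by
  refine map_mem_closure (conj_continuous u) hX fun Y hY => ?_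
  have : StarAlgebra.adjoin ℂ s
      ≤ (StarAlgebra.adjoin ℂ s).comap (StarAlgHomClass.toStarAlgHom u.conjStarAlgEquiv) :=
    StarAlgebra.adjoin_le fun Z hZ => StarAlgebra.subset_adjoin ℂ s (hs Z hZ)
  exact this hY

/-- The restriction of the conjugation by a unitary `u` to a `*`-subalgebra that is invariant under
it and its inverse. -/
def conjRestrict (u : V ≃ₗᵢ[ℂ] V) (S : StarSubalgebra ℂ (V →L[ℂ] V))
    (h1 : ∀ X ∈ S, u.conjStarAlgEquiv X ∈ S) (h2 : ∀ X ∈ S, u.symm.conjStarAlgEquiv X ∈ S) :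
    S ≃⋆ₐ[ℂ] S where
  toFun X := ⟨u.conjStarAlgEquiv X, h1 X X.2⟩
  invFun X := ⟨u.symm.conjStarAlgEquiv X, h2 X X.2⟩
  left_inv X := Subtype.ext (u.conjStarAlgEquiv.symm_apply_apply X.1)
  right_inv X := Subtype.ext (u.conjStarAlgEquiv.apply_symm_apply X.1)
  map_mul' X Y := Subtype.ext (map_mul u.conjStarAlgEquiv X.1 Y.1)
  map_add' X Y := Subtype.ext (map_add u.conjStarAlgEquiv X.1 Y.1)
  map_star' X := Subtype.ext (map_star u.conjStarAlgEquiv X.1)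
  map_smul' c X := Subtype.ext (map_smul u.conjStarAlgEquiv c X.1)

/-- The vector functional `X ↦ ⟨v, X v⟩` on a `*`-subalgebra of operators. -/
def vectorFunctional (S : StarSubalgebra ℂ (V →L[ℂ] V)) (v : V) : S →L[ℂ] ℂ :=
  LinearMap.mkContinuousOfExistsBound
    { toFun := fun X => ⟪v, (X : V →L[ℂ] V) v⟫_ℂ
      map_add' := fun X Y => inner_add_right _ _ _
      map_smul' := fun c X => inner_smul_right _ _ _ } <| by
    refine ⟨‖v‖ * ‖v‖, fun X => ?_⟩
    calc ‖⟪v, (X : V →L[ℂ] V) v⟫_ℂ‖ ≤ ‖v‖ * ‖(X : V →L[ℂ] V) v‖ := norm_inner_le_norm _ _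
      _ ≤ ‖v‖ * (‖(X : V →L[ℂ] V)‖ * ‖v‖) := by
          gcongr; exact ContinuousLinearMap.le_opNorm _ _
      _ = ‖v‖ * ‖v‖ * ‖(X : V →L[ℂ] V)‖ := by ring

end Conjugation

/-- Conjugation by the second quantization of the shift maps `a_j` to `a_{j+1}`. -/
theorem conj_annihilation (hT : IsYangBaxterHecke T) (hU : Commute T (shiftOp 2))
    (hM : BddAbove (Set.range fun n => ‖R T n‖)) (j : ℤ) :
    (fockShift hT hU).conjStarAlgEquiv (annihilation hT hM (basisVec j))
      = annihilation hT hM (basisVec (j + 1)) := by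
  have h : (fockShift hT hU).conjStarAlgEquiv (creation hT hM (basisVec j))
      = creation hT hM (basisVec (j + 1)) := by
    ext1 ξ
    rw [LinearIsometryEquiv.conjStarAlgEquiv_apply_apply, fockShift_creation, shift_basisVec,
      LinearIsometryEquiv.apply_symm_apply]
  rw [annihilation, conj_adjoint, h]
  rfl

theorem conj_mem (hT : IsYangBaxterHecke T) (hU : Commute T (shiftOp 2))
    (hM : BddAbove (Set.range fun n => ‖R T n‖)) (X : FockSpace hT →L[ℂ] FockSpace hT)
    (hX : X ∈ fockAlgebra hT hM) : (fockShift hT hU).conjStarAlgEquiv X ∈ fockAlgebra hT hM := by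
  refine conj_mem_closure _ _ ?_ hX
  rintro _ ⟨j, rfl⟩
  exact ⟨j + 1, (conj_annihilation hT hU hM j).symm⟩

theorem conj_symm_mem (hT : IsYangBaxterHecke T) (hU : Commute T (shiftOp 2))
    (hM : BddAbove (Set.range fun n => ‖R T n‖)) (X : FockSpace hT →L[ℂ] FockSpace hT)
    (hX : X ∈ fockAlgebra hT hM) :
    (fockShift hT hU).symm.conjStarAlgEquiv X ∈ fockAlgebra hT hM := by
  refine conj_mem_closure _ _ ?_ hX
  rintro _ ⟨j, rfl⟩
  refine ⟨j - 1, ?_⟩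
  have h := conj_annihilation hT hU hM (j - 1)
  rw [sub_add_cancel] at h
  change annihilation hT hM (basisVec (j - 1))
    = (fockShift hT hU).symm.conjStarAlgEquiv (annihilation hT hM (basisVec j))
  rw [← h]
  exact ((fockShift hT hU).conjStarAlgEquiv.symm_apply_apply _).symm

/-- The shift automorphism `α` of the C⋆-algebra generated by the annihilators: the restriction of
the conjugation by the second quantization of the shift. -/
def shiftAut (hT : IsYangBaxterHecke T) (hU : Commute T (shiftOp 2))
    (hM : BddAbove (Set.range fun n => ‖R T n‖)) : fockAlgebra hT hM ≃⋆ₐ[ℂ] fockAlgebra hT hM :=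
  conjRestrict (fockShift hT hU) (fockAlgebra hT hM) (conj_mem hT hU hM) (conj_symm_mem hT hU hM)

/-- The Fock vacuum expectation `ω(X) = ⟨Ω, X Ω⟩` on the C⋆-algebra generated by the
annihilators. -/
def vacuumState (hT : IsYangBaxterHecke T) (hM : BddAbove (Set.range fun n => ‖R T n‖)) :
    fockAlgebra hT hM →L[ℂ] ℂ :=
  vectorFunctional (fockAlgebra hT hM) (vacuum hT)

/-- The matrix elements `t_{ij}^{kl}` of `T`, given by `T (e_i ⊗ e_j) = ∑ t_{ij}^{kl} e_k ⊗ e_l`. -/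
def coeff (T : Op 2) (i j k l : ℤ) : ℂ := T (lp.single 2 ![i, j] (1 : ℂ)) ![k, l]

end Fock

section Ergodic

open scoped ComplexOrder

variable {A : Type*} [NormedRing A] [StarRing A] [NormedAlgebra ℂ A]

/-- States of a unital C⋆-algebra: positive linear functionals with value `1` at the unit. -/
structure IsState (φ : A →L[ℂ] ℂ) : Prop where
  nonneg : ∀ a, 0 ≤ φ (star a * a)
  map_one : φ 1 = 1

/-- The C⋆-dynamical system given by a unital C⋆-algebra and an automorphism `α` is uniquely mixing
with respect to the state `ω`: `f (αⁿ a) → f(1) ω(a)` as `n → ∞`, for all elements `a` and all bounded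
linear functionals `f`. -/
def IsUniquelyMixing (α : A ≃⋆ₐ[ℂ] A) (ω : A →L[ℂ] ℂ) : Prop :=
  IsState ω ∧ ∀ (a : A) (f : A →L[ℂ] ℂ),
    Filter.Tendsto (fun n : ℕ => f (α^[n] a)) Filter.atTop (nhds (f 1 * ω a))

end Ergodic

end DeformedFock

end

noncomputable section

namespace DeformedFock

variable {T : Op 2}

/-! Two facts about the creators carry the proof.

The first is the commutation rule. By the definition of the deformed inner product, `a_i` acts in
degree `n + 1` as `R⁽ⁿ⁺¹⁾` followed by contraction of the first factor with `e_i`. The recursion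
`R⁽ⁿ⁺¹⁾ = I + T₁ (I ⊗ R⁽ⁿ⁾)` then turns into `a_i a_j† = δ_ij + ∑ t a_k† a_l`
(`annihilation_mul_creation`). Since these sums are finite, every word in creators and annihilators
is a finite combination of words with the creators on the left
(`closure_subset_span_normalOrdered`). Such combinations are dense, and both `α` and the functionals
are uniformly continuous, so it suffices to treat one normally ordered word.

The second is a row estimate. From `P⁽ⁿ⁺¹⁾ ≤ ‖R⁽ⁿ⁺¹⁾‖ (I ⊗ P⁽ⁿ⁾)` and the orthogonality of the `e_s`
one gets `‖∑ a_s† η_s‖² ≤ M ∑ ‖η_s‖²` (`norm_sum_creation_le`). For a word `a_j† Y` one has `αⁿ(a_j†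
Y) = a_{j+n}† αⁿ(Y)`, where the creators have distinct indices and `‖αⁿ(Y)‖ = ‖Y‖`. Hence `‖∑ cₙ
αⁿ(a_j† Y)‖² ≤ M ‖Y‖² ∑ |cₙ|²`. Testing a bounded functional `f` on the combination with `cₙ`
conjugate to `f(αⁿ(a_j† Y))` shows that these values are square summable, so they tend to zero
(`HasSquareBoundedOrbit.tendsto`). Words ending in an annihilator follow by taking adjoints. The
vacuum state vanishes on both kinds of word, and the only word left is `I`.

Uniqueness is formal: along an orbit an invariant state is constant, and its limit there is `ω`. -/

/-! ### Annihilators on tensor powers and the commutation rule -/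

/-- All slices of `e_z ⊗ η` other than the one at `z` vanish. This gives both the formula for the
annihilator and the orthogonality behind the row estimate. -/
theorem inner_tensorVec_amplify {X Y Z : Type} [DecidableEq Z] (e : X ≃ Z × Y)
    (A : L2 Y →L[ℂ] L2 Y) (z : Z) (η : L2 Y) (ξ : L2 X) :
    ⟪tensorVec e (lp.single 2 z (1 : ℂ)) η, amplify e A ξ⟫_ℂ = ⟪η, A (slice e z ξ)⟫_ℂ := by
  have h := hasSum_slice_inner e (tensorVec e (lp.single 2 z (1 : ℂ)) η) (amplify e A ξ)
  have h1 : (fun z' => ⟪slice e z' (tensorVec e (lp.single 2 z (1 : ℂ)) η),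
      slice e z' (amplify e A ξ)⟫_ℂ) z = ⟪η, A (slice e z ξ)⟫_ℂ := by
    simp only [slice_tensorVec, slice_amplify, lp.single_apply_self, one_smul]
  refine h.unique (h1 ▸ hasSum_single z fun z' hz' => ?_)
  rw [slice_tensorVec, lp.single_apply_ne _ _ _ hz', zero_smul, inner_zero_left]

theorem annihilation_toFock_zero (hT : IsYangBaxterHecke T)
    (hM : BddAbove (Set.range fun n => ‖R T n‖)) (f : L2 ℤ) (ξ : TensorPower 0) :
    annihilation hT hM f (toFock hT 0 ξ) = 0 := by
  refine ext_inner_left ℂ fun v => ?_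
  rw [annihilation, ContinuousLinearMap.adjoint_inner_right, toFock, lp.inner_single_right,
    inner_zero_right]
  exact inner_zero_left _

/-- The annihilator `a_i` acts on the `(n+1)`-particle space as `(⟨e_i| ⊗ I) R⁽ⁿ⁺¹⁾`. -/
theorem annihilation_toFock_succ (hT : IsYangBaxterHecke T)
    (hM : BddAbove (Set.range fun n => ‖R T n‖)) (i : ℤ) (n : ℕ) (ξ : TensorPower (n + 1)) :
    annihilation hT hM (basisVec i) (toFock hT (n + 1) ξ)
      = toFock hT n (slice (headTail n) i (R T (n + 1) ξ)) := by
  refine ext_inner_left ℂ fun v => ?_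
  rw [annihilation, ContinuousLinearMap.adjoint_inner_right, toFock, lp.inner_single_right,
    toFock, lp.inner_single_right, creation, raise_apply_succ]
  generalize v n = x
  induction x using UniformSpace.Completion.induction_on with
  | hp => exact isClosed_eq (by fun_prop) (by fun_prop)
  | ih x =>
    obtain ⟨η, rfl⟩ := (toDeformed hT n).surjective x
    rw [creationParticle_coe, UniformSpace.Completion.inner_coe, UniformSpace.Completion.inner_coe,
      deformed_inner, deformed_inner]
    -- `P T (n + 1)` is by definition `idTensor (P T n) * R T (n + 1)`. The factor `I ⊗ P⁽ⁿ⁾`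
    -- becomes the deformed inner product in degree `n`, and `R⁽ⁿ⁺¹⁾` stays with the annihilator.
    exact inner_tensorVec_amplify (headTail n) (P T n) i η (R T (n + 1) ξ)

/-- Two bounded operators on the Fock space are equal if they agree on all vectors of the tensor
powers. -/
theorem fock_ext (hT : IsYangBaxterHecke T) {A B : FockSpace hT →L[ℂ] FockSpace hT}
    (h : ∀ n ξ, A (toFock hT n ξ) = B (toFock hT n ξ)) : A = B := by
  refine lp.ext_continuousLinearMap (𝕜 := ℂ) (by norm_num) fun n => ?_
  ext1 x
  induction x using UniformSpace.Completion.induction_on with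
  | hp => exact isClosed_eq (ContinuousLinearMap.continuous _) (ContinuousLinearMap.continuous _)
  | ih x =>
    obtain ⟨ξ, rfl⟩ := (toDeformed hT n).surjective x
    exact h n ξ

/-- The map `toFock` as a linear map. -/
def toFockLinear (hT : IsYangBaxterHecke T) (n : ℕ) : TensorPower n →ₗ[ℂ] FockSpace hT where
  toFun := toFock hT n
  map_add' ξ η := by
    rw [toFock, map_add, UniformSpace.Completion.coe_add, lp.single_add]
    rfl
  map_smul' c ξ := by
    rw [toFock, map_smul, UniformSpace.Completion.coe_smul, lp.single_smul]
    rfl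

theorem toFockLinear_apply (hT : IsYangBaxterHecke T) (n : ℕ) (ξ : TensorPower n) :
    toFockLinear hT n ξ = toFock hT n ξ := rfl

/-- Expansion of `T₁ (e_j ⊗ ζ)` in matrix elements of `T`. No finiteness is needed here: the series
over `l` converges because the slice is an `ℓ²` vector and taking a coordinate of `T v` is
continuous in `v`. -/
theorem hasSum_tensorId_tensorVec (T : Op 2) (n : ℕ) (i j k : ℤ) (ζ : TensorPower (n + 1))
    (y : Fin n → ℤ) :
    HasSum (fun l => coeff T j l i k * ζ (Fin.cons l y))
      (tensorId T n (tensorVec (headTail (n + 1)) (basisVec j) ζ) (Fin.cons i (Fin.cons k y))) := by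
  set ξ : TensorPower 2 := slice (headTwo n) y (tensorVec (headTail (n + 1)) (basisVec j) ζ)
    with hξ
  have hξ' : ∀ p, ξ p = basisVec j (p 0) * ζ (Fin.cons (p 1) y) := fun p => rfl
  have hx : headTwo n (Fin.cons i (Fin.cons k y)) = (y, ![i, k]) := rfl
  rw [tensorId, amplify_apply, hx]
  have h1 := (lp.hasSum_single (p := 2) (by norm_num) ξ).mapL
    (innerSL ℂ (lp.single 2 ![i, k] (1 : ℂ) : TensorPower 2) ∘L T)
  have hev : ∀ v : TensorPower 2, (innerSL ℂ (lp.single 2 ![i, k] (1 : ℂ) : TensorPower 2) ∘L T) v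
      = T v ![i, k] := by
    intro v
    change ⟪_, T v⟫_ℂ = _
    rw [lp.inner_single_left]
    simp
  simp only [hev] at h1
  have hT1 : ∀ (p : Fin 2 → ℤ) (c : ℂ), T (lp.single 2 p c) ![i, k]
      = c * T (lp.single 2 p (1 : ℂ)) ![i, k] := by
    intro p c
    have h : lp.single (E := fun _ : Fin 2 → ℤ => ℂ) 2 p c = c • lp.single 2 p (1 : ℂ) := by
      rw [← lp.single_smul, smul_eq_mul, mul_one]
    rw [h, map_smul]
    rfl
  have hinj : Function.Injective fun l : ℤ => (![j, l] : Fin 2 → ℤ) := fun a b h => congrFun h 1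
  -- The slice is `e_j` tensored with a vector, so only index pairs `(j, l)` contribute.
  rw [← hinj.hasSum_iff] at h1
  · refine (congrArg (HasSum · _) (funext fun l => ?_)).mpr h1
    change _ = T (lp.single 2 ![j, l] (ξ ![j, l])) ![i, k]
    rw [hT1, hξ', coeff]
    simp [basisVec, mul_comm]
  · intro p hp
    have hp0 : p 0 ≠ j := by
      rintro rfl
      refine hp ⟨p 1, funext fun m => ?_⟩
      fin_cases m <;> rfl
    rw [hT1, hξ', basisVec, lp.single_apply_ne _ _ _ hp0, zero_mul, zero_mul]

/-- The commutation rule on tensor powers. In `R⁽ⁿ⁺²⁾ (e_j ⊗ ξ) = e_j ⊗ ξ + T₁ (e_j ⊗ R⁽ⁿ⁺¹⁾ ξ)` the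
first term yields `δ_ij` and the second the sum over the coefficients. -/
theorem slice_R_tensorVec (T : Op 2) (hfin : ∀ i j : ℤ, {p : ℤ × ℤ | coeff T j p.2 i p.1 ≠ 0}.Finite)
    (i j : ℤ) (n : ℕ) (ξ : TensorPower (n + 1)) :
    slice (headTail (n + 1)) i (R T (n + 2) (tensorVec (headTail (n + 1)) (basisVec j) ξ))
      = (if i = j then ξ else 0) + ∑ p ∈ (hfin i j).toFinset, coeff T j p.2 i p.1 •
        tensorVec (headTail n) (basisVec p.1) (slice (headTail n) p.2 (R T (n + 1) ξ)) := by
  set ζ := R T (n + 1) ξ with hζ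
  have hR : R T (n + 2) (tensorVec (headTail (n + 1)) (basisVec j) ξ)
      = tensorVec (headTail (n + 1)) (basisVec j) ξ
        + tensorId T n (tensorVec (headTail (n + 1)) (basisVec j) ζ) := by
    rw [R_succ, add_apply, one_apply_eq_self, mul_apply_eq_comp, idTensor, amplify_tensorVec]
    rfl
  rw [hR, slice_add]
  congr 1
  · rw [slice_tensorVec, basisVec]
    split_ifs with h
    · simp [h]
    · rw [lp.single_apply_ne _ _ _ h, zero_smul]
  · apply lp.ext
    funext x
    obtain ⟨⟨k, y⟩, rfl⟩ := (headTail n).symm.surjective x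
    refine (hasSum_tensorId_tensorVec T n i j k ζ y).unique ?_
    -- At a coordinate with first entry `k`, only the pairs `(k, l)` survive, and they are
    -- determined by `l`.
    have h : (∑ p ∈ (hfin i j).toFinset, coeff T j p.2 i p.1 • tensorVec (headTail n)
        (basisVec p.1) (slice (headTail n) p.2 ζ)) ((headTail n).symm (k, y))
        = ∑ l ∈ ((hfin i j).toFinset.filter fun p => p.1 = k).image Prod.snd,
          coeff T j l i k * ζ (Fin.cons l y) := by
      rw [Finset.sum_image, Finset.sum_filter, lp.coeFn_sum, Finset.sum_apply]
      · refine Finset.sum_congr rfl fun p _ => ?_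
        rw [lp.coeFn_smul, Pi.smul_apply, tensorVec_apply, Equiv.apply_symm_apply, slice_apply,
          smul_eq_mul]
        split_ifs with hp
        · subst hp
          simp only [basisVec, lp.single_apply_self, one_mul]
          rfl
        · rw [basisVec, lp.single_apply_ne _ _ _ (Ne.symm hp), zero_mul, mul_zero]
      · rintro p hp p' hp' h
        simp only [Finset.coe_filter, Set.mem_ofPred_eq] at hp hp'
        exact Prod.ext (hp.2.trans hp'.2.symm) h
    rw [h]
    refine hasSum_sum_of_ne_finset_zero fun l hl => ?_
    have : coeff T j l i k = 0 := by
      by_contra hne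
      exact hl (Finset.mem_image.2 ⟨(k, l), by simpa using hne, rfl⟩)
    rw [this, zero_mul]

theorem annihilation_mul_creation (hT : IsYangBaxterHecke T)
    (hfin : ∀ i j : ℤ, {p : ℤ × ℤ | coeff T j p.2 i p.1 ≠ 0}.Finite)
    (hM : BddAbove (Set.range fun n => ‖R T n‖)) (i j : ℤ) :
    annihilation hT hM (basisVec i) * creation hT hM (basisVec j)
      = (if i = j then 1 else 0) + ∑ p ∈ (hfin i j).toFinset, coeff T j p.2 i p.1 •
        (creation hT hM (basisVec p.1) * annihilation hT hM (basisVec p.2)) := by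
  refine fock_ext hT fun n ξ => ?_
  have h1 : (if i = j then 1 else 0 : FockSpace hT →L[ℂ] FockSpace hT) (toFock hT n ξ)
      = toFockLinear hT n (if i = j then ξ else 0) := by
    split_ifs
    · rfl
    · exact (map_zero _).symm
  rw [mul_apply_eq_comp, creation_toFock, annihilation_toFock_succ, add_apply, sum_apply, h1]
  simp only [smul_apply, mul_apply_eq_comp]
  cases n with
  | zero =>
    simp only [annihilation_toFock_zero, map_zero, smul_zero, Finset.sum_const_zero, add_zero]
    have hR : R T 1 = 1 := by
      rw [R_succ]
      -- `leg T 1 0` has the default value `0`, so the recursion for `R` also holds in degree one.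
      change 1 + 0 * _ = (1 : Op 1)
      rw [zero_mul, add_zero]
    rw [hR, one_apply_eq_self, slice_tensorVec, toFockLinear_apply]
    congr 1
    split_ifs with h
    · simp [h, basisVec]
    · rw [basisVec, lp.single_apply_ne _ _ _ h, zero_smul]
  | succ n =>
    simp only [annihilation_toFock_succ, creation_toFock]
    rw [slice_R_tensorVec T hfin, ← toFockLinear_apply]
    simp only [map_add, map_sum, map_smul]
    rfl

/-! ### The row estimate for creators -/

/-- After `P⁽ⁿ⁺¹⁾` is bounded by `‖R⁽ⁿ⁺¹⁾‖ (I ⊗ P⁽ⁿ⁾)`, no further loss occurs: for the form of `I ⊗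
P⁽ⁿ⁾` the vectors `e_s ⊗ η_s` are mutually orthogonal. -/
theorem norm_sum_tensorVec_le (hT : IsYangBaxterHecke T) (n : ℕ) (F : Finset ℤ)
    (η : ℤ → TensorPower n) :
    ‖toDeformed hT (n + 1) (∑ s ∈ F, tensorVec (headTail n) (basisVec s) (η s))‖ ^ 2
      ≤ ‖R T (n + 1)‖ * ∑ s ∈ F, ‖toDeformed hT n (η s)‖ ^ 2 := by
  rw [deformed_norm_sq]
  refine (inner_P_succ_le hT n _).trans (le_of_eq ?_)
  congr 1
  rw [sum_inner, Complex.re_sum]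
  refine Finset.sum_congr rfl fun s hs => ?_
  rw [deformed_norm_sq, idTensor, basisVec, inner_tensorVec_amplify]
  congr 3
  apply lp.ext
  funext y
  rw [slice_apply, lp.coeFn_sum, Finset.sum_apply, Finset.sum_eq_single s]
  · simp [tensorVec_apply, basisVec]
  · intro t _ hts
    simp [tensorVec_apply, basisVec, hts.symm]
  · exact fun h => (h hs).elim

theorem norm_sum_creationParticle_le (hT : IsYangBaxterHecke T) (n : ℕ) (F : Finset ℤ)
    (x : ℤ → ParticleSpace hT n) :
    ‖∑ s ∈ F, creationParticle hT (basisVec s) n (x s)‖ ^ 2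
      ≤ ‖R T (n + 1)‖ * ∑ s ∈ F, ‖x s‖ ^ 2 := by
  -- Both sides are continuous in the whole family `x` for the product topology, so it is enough to
  -- check families of uncompleted vectors.
  have hd : DenseRange (Pi.map fun (_ : ℤ) (v : DeformedPower hT n) => (v : ParticleSpace hT n)) :=
    DenseRange.piMap fun _ => UniformSpace.Completion.denseRange_coe
  refine isClosed_property hd (p := fun x : ℤ → ParticleSpace hT n =>
    ‖∑ s ∈ F, creationParticle hT (basisVec s) n (x s)‖ ^ 2
      ≤ ‖R T (n + 1)‖ * ∑ s ∈ F, ‖x s‖ ^ 2) (isClosed_le (by fun_prop) (by fun_prop))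
    (fun v => ?_) x
  have h := norm_sum_tensorVec_le hT n F fun s => (toDeformed hT n).symm (v s)
  rw [map_sum, ← UniformSpace.Completion.norm_coe] at h
  refine le_of_eq_of_le ?_ (h.trans_eq ?_)
  · congr 2
    change _ = UniformSpace.Completion.toComplL (𝕜 := ℂ) _
    rw [map_sum]
    exact Finset.sum_congr rfl fun s _ =>
      creationParticle_coe hT (basisVec s) n ((toDeformed hT n).symm (v s))
  · simp only [Pi.map_apply, UniformSpace.Completion.norm_coe, LinearEquiv.apply_symm_apply]

/-- Creators raise the degree by exactly one, so the estimates in the separate degrees add up. The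
bound does not depend on the size of `F`, which is what makes orbits square bounded. -/
theorem norm_sum_creation_le (hT : IsYangBaxterHecke T)
    (hM : BddAbove (Set.range fun n => ‖R T n‖)) {M : ℝ} (hR : ∀ n, ‖R T n‖ ≤ M) (F : Finset ℤ)
    (η : ℤ → FockSpace hT) :
    ‖∑ s ∈ F, creation hT hM (basisVec s) (η s)‖ ^ 2 ≤ M * ∑ s ∈ F, ‖η s‖ ^ 2 := by
  set ζ := ∑ s ∈ F, creation hT hM (basisVec s) (η s) with hζ
  have h0 : ζ 0 = 0 := by
    rw [hζ, lp.coeFn_sum, Finset.sum_apply]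
    exact Finset.sum_eq_zero fun s _ => rfl
  have hs : ∀ n, ζ (n + 1) = ∑ s ∈ F, creationParticle hT (basisVec s) n (η s n) := by
    intro n
    rw [hζ, lp.coeFn_sum, Finset.sum_apply]
    rfl
  have hsum : HasSum (fun n => M * ∑ s ∈ F, ‖η s n‖ ^ 2) (M * ∑ s ∈ F, ‖η s‖ ^ 2) := by
    refine (hasSum_sum fun s _ => ?_).mul_left M
    rw [norm_sq_eq']
    exact (summable_sq' _).hasSum
  rw [norm_sq_eq', (summable_sq' ζ).tsum_eq_zero_add, h0, norm_zero, zero_pow two_ne_zero, zero_add,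
    ← hsum.tsum_eq]
  refine Summable.tsum_le_tsum (fun n => ?_) ((summable_nat_add_iff 1).2 (summable_sq' ζ))
    hsum.summable
  rw [hs]
  refine (norm_sum_creationParticle_le hT n F fun s => η s n).trans ?_
  gcongr
  exact hR _


/-! ### Normal ordering of words -/

open scoped Pointwise in
/-- If all products `a_i b_j` are combinations of `1` and the `b_k a_l`, then every word in the `a_i`
and `b_j` is a combination of normally ordered words. -/
theorem closure_subset_span_normalOrdered {A ι : Type*} [Ring A] [Algebra ℂ A] (a b : ι → A)
    (h : ∀ i j, a i * b j ∈ Submodule.span ℂ ({1} ∪ {x | ∃ k l, x = b k * a l})) :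
    (Submonoid.closure (Set.range a ∪ Set.range b) : Set A) ⊆ Submodule.span ℂ
      ((Submonoid.closure (Set.range b) : Set A) * (Submonoid.closure (Set.range a) : Set A)) := by
  set W := Submodule.span ℂ
      ((Submonoid.closure (Set.range b) : Set A) * (Submonoid.closure (Set.range a) : Set A)) with hW
  have hb : ∀ k, ∀ x ∈ W, b k * x ∈ W := by
    intro k x hx
    induction hx using Submodule.span_induction with
    | mem x hx =>
      obtain ⟨u, hu, v, hv, rfl⟩ := hx
      refine Submodule.subset_span ⟨b k * u, ?_, v, hv, mul_assoc _ _ _⟩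
      exact mul_mem (Submonoid.subset_closure ⟨k, rfl⟩) hu
    | zero => simp
    | add x y _ _ hx hy => rw [mul_add]; exact add_mem hx hy
    | smul c x _ hx => rw [mul_smul_comm]; exact W.smul_mem c hx
  -- The index `i` is quantified after `u` because moving `a i` past a creator replaces it by
  -- another `a l`, to which the induction hypothesis must apply.
  have ha : ∀ u ∈ Submonoid.closure (Set.range b), ∀ v ∈ Submonoid.closure (Set.range a), ∀ i,
      a i * (u * v) ∈ W := by
    intro u hu v hv
    induction hu using Submonoid.closure_induction_left with
    | one =>
      refine fun i => Submodule.subset_span ⟨1, one_mem _, a i * v, ?_, by simp⟩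
      exact mul_mem (Submonoid.subset_closure ⟨i, rfl⟩) hv
    | mul_left x hx u hu ih =>
      obtain ⟨j, rfl⟩ := hx
      intro i
      have hle : Submodule.span ℂ ({1} ∪ {x | ∃ k l, x = b k * a l})
          ≤ W.comap (LinearMap.mulRight ℂ (u * v)) := by
        refine Submodule.span_le.2 ?_
        rintro _ (rfl | ⟨k, l, rfl⟩)
        · change 1 * (u * v) ∈ W
          rw [one_mul]
          exact Submodule.subset_span ⟨u, hu, v, hv, rfl⟩
        · change b k * a l * (u * v) ∈ W
          rw [mul_assoc]
          exact hb k _ (ih l)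
      have := hle (h i j)
      change a i * b j * (u * v) ∈ W at this
      simpa only [mul_assoc] using this
  intro x hx
  induction hx using Submonoid.closure_induction_left with
  | one => exact Submodule.subset_span ⟨1, one_mem _, 1, one_mem _, mul_one _⟩
  | mul_left x hx y _ hy =>
    rcases hx with ⟨i, rfl⟩ | ⟨j, rfl⟩
    · have hle : W ≤ W.comap (LinearMap.mulLeft ℂ (a i)) := by
        refine Submodule.span_le.2 ?_
        rintro _ ⟨u, hu, v, hv, rfl⟩
        exact ha u hu v hv i
      exact hle hy
    · exact hb j y hy

/-! ### Square bounded orbits and unique mixing -/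

section SquareSummable

variable {A : Type*} [NormedRing A] [StarRing A] [NormedAlgebra ℂ A]

/-- The orbit of `a` under `α` is an `ℓ²`-bounded sequence: its finite linear combinations are bounded
by the `ℓ²`-norm of the coefficients. -/
def HasSquareBoundedOrbit (α : A ≃⋆ₐ[ℂ] A) (a : A) : Prop :=
  ∃ C : ℝ, ∀ (N : ℕ) (c : ℕ → ℂ),
    ‖∑ n ∈ Finset.range N, c n • α^[n] a‖ ^ 2 ≤ C * ∑ n ∈ Finset.range N, ‖c n‖ ^ 2

/-- The adjoint is isometric and commutes with `α`, and conjugating the coefficients preserves their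
`ℓ²`-norm. This transfers the estimate from words starting with a creator to words ending with an
annihilator. -/
theorem HasSquareBoundedOrbit.star [NormedStarGroup A] [StarModule ℂ A] {α : A ≃⋆ₐ[ℂ] A} {a : A}
    (h : HasSquareBoundedOrbit α a) : HasSquareBoundedOrbit α (star a) := by
  obtain ⟨C, hC⟩ := h
  refine ⟨C, fun N c => ?_⟩
  have := hC N fun n => Star.star (c n)
  simp only [norm_star] at this
  refine le_of_eq_of_le ?_ this
  rw [← norm_star, star_sum]
  congr 2
  refine Finset.sum_congr rfl fun n _ => ?_
  rw [star_smul]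
  congr 1
  refine (Function.Semiconj.iterate_right (f := Star.star) (ga := α) (gb := α)
    (fun x => (map_star α x).symm) n (Star.star a)).trans ?_
  rw [star_star]

/-- Bounded functionals tend to zero along `ℓ²`-bounded orbits. -/
theorem HasSquareBoundedOrbit.tendsto {α : A ≃⋆ₐ[ℂ] A} {a : A} (h : HasSquareBoundedOrbit α a)
    (f : A →L[ℂ] ℂ) : Filter.Tendsto (fun n : ℕ => f (α^[n] a)) Filter.atTop (nhds 0) := by
  obtain ⟨C, hC⟩ := h
  have hb : ∀ N, ∑ n ∈ Finset.range N, ‖f (α^[n] a)‖ ^ 2 ≤ ‖f‖ ^ 2 * C := by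
    intro N
    set S := ∑ n ∈ Finset.range N, ‖f (α^[n] a)‖ ^ 2 with hS
    have hS0 : 0 ≤ S := Finset.sum_nonneg fun _ _ => by positivity
    -- With these coefficients `f` maps the combination to `S` itself, so the orbit bound gives `S²
    -- ≤ ‖f‖² C S` and `S` can be cancelled.
    set c : ℕ → ℂ := fun n => Star.star (f (α^[n] a)) with hc
    have h1 : f (∑ n ∈ Finset.range N, c n • α^[n] a) = (S : ℂ) := by
      rw [map_sum, hS]
      push_cast
      refine Finset.sum_congr rfl fun n _ => ?_
      rw [map_smul, smul_eq_mul]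
      exact RCLike.conj_mul (K := ℂ) _
    have h2 := hC N c
    simp only [hc, norm_star] at h2
    rw [← hS] at h2
    have h3 : S ^ 2 ≤ (‖f‖ ^ 2 * C) * S := by
      calc S ^ 2 = ‖f (∑ n ∈ Finset.range N, c n • α^[n] a)‖ ^ 2 := by
            rw [h1, Complex.norm_real, Real.norm_eq_abs, sq_abs]
        _ ≤ (‖f‖ * ‖∑ n ∈ Finset.range N, c n • α^[n] a‖) ^ 2 := by
            gcongr
            exact f.le_opNorm _
        _ ≤ ‖f‖ ^ 2 * (C * S) := by
            rw [mul_pow]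
            gcongr
        _ = _ := by ring
    rcases hS0.eq_or_lt with h0 | h0
    · have hC0 : 0 ≤ C := by
        have := (sq_nonneg _).trans (hC 1 fun _ => 1)
        simpa using this
      rw [← h0]
      positivity
    · exact le_of_mul_le_mul_right (by rwa [← sq]) h0
  have hs : Summable fun n => ‖f (α^[n] a)‖ ^ 2 :=
    summable_of_sum_range_le (fun _ => by positivity) hb
  have h0 := (hs.tendsto_atTop_zero).sqrt
  simp only [Real.sqrt_sq (norm_nonneg _), Real.sqrt_zero] at h0
  exact tendsto_zero_iff_norm_tendsto_zero.2 h0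

/-- Convergence `f (αⁿ a) → f(1) ω(a)` passes to limits in `a` if the iterates of `α` are
contractive. -/
theorem tendsto_of_mem_closure {α : A ≃⋆ₐ[ℂ] A} (hα : ∀ (n : ℕ) a, ‖α^[n] a‖ ≤ ‖a‖) (f ω : A →L[ℂ] ℂ)
    {s : Set A}
    (hs : ∀ a ∈ s, Filter.Tendsto (fun n : ℕ => f (α^[n] a)) Filter.atTop (nhds (f 1 * ω a)))
    {a : A} (ha : a ∈ closure s) :
    Filter.Tendsto (fun n : ℕ => f (α^[n] a)) Filter.atTop (nhds (f 1 * ω a)) := by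
  rw [Metric.tendsto_atTop]
  intro ε hε
  -- A Lipschitz constant, uniform in `n`, for `a ↦ f (αⁿ a) - f(1) ω(a)`; the summand `1` makes it
  -- positive.
  set K := ‖f‖ + ‖f 1‖ * ‖ω‖ + 1 with hK
  have hK0 : 0 < K := by positivity
  obtain ⟨b, hb, hab⟩ := Metric.mem_closure_iff.1 ha (ε / 2 / K) (by positivity)
  obtain ⟨N, hN⟩ := Metric.tendsto_atTop.1 (hs b hb) (ε / 2) (by positivity)
  refine ⟨N, fun n hn => ?_⟩
  have h1 := hN n hn
  rw [dist_eq_norm] at h1 hab ⊢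
  have hsub : α^[n] (a - b) = α^[n] a - α^[n] b := iterate_map_sub α n a b
  have e : f (α^[n] a) - f 1 * ω a
      = (f (α^[n] (a - b)) - f 1 * ω (a - b)) + (f (α^[n] b) - f 1 * ω b) := by
    rw [hsub, map_sub, map_sub]
    ring
  have h2 : ‖f (α^[n] (a - b)) - f 1 * ω (a - b)‖ ≤ K * ‖a - b‖ := by
    calc _ ≤ ‖f (α^[n] (a - b))‖ + ‖f 1 * ω (a - b)‖ := norm_sub_le _ _
      _ ≤ ‖f‖ * ‖a - b‖ + ‖f 1‖ * (‖ω‖ * ‖a - b‖) := by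
          rw [norm_mul]
          gcongr
          · exact (f.le_opNorm _).trans (by gcongr; exact hα n _)
          · exact ω.le_opNorm _
      _ ≤ K * ‖a - b‖ := by
          rw [hK]
          nlinarith [norm_nonneg (a - b)]
  have h3 : K * ‖a - b‖ < ε / 2 := by
    rwa [lt_div_iff₀ hK0, mul_comm] at hab
  rw [e]
  exact (norm_add_le _ _).trans_lt (by linarith)

/-- A uniquely mixing system has exactly one invariant state. -/
theorem IsUniquelyMixing.invariant_eq {α : A ≃⋆ₐ[ℂ] A} {ω : A →L[ℂ] ℂ}
    (h : IsUniquelyMixing α ω) :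
    {φ : A →L[ℂ] ℂ | IsState φ ∧ ∀ a, φ (α a) = φ a} = {ω} := by
  obtain ⟨hω, h⟩ := h
  ext φ
  constructor
  · rintro ⟨hφ, hinv⟩
    refine ContinuousLinearMap.ext fun a => ?_
    have h1 := h a φ
    have h2 : ∀ n : ℕ, φ (α^[n] a) = φ a := by
      intro n
      induction n with
      | zero => rfl
      | succ n ih => rw [Function.iterate_succ_apply', hinv, ih]
    simp only [h2, hφ.map_one, one_mul] at h1
    exact tendsto_nhds_unique tendsto_const_nhds h1
  · rintro rfl
    refine ⟨hω, fun a => ?_⟩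
    -- Invariance of `ω` also comes from mixing: the sequence `ω (αⁿ⁺¹ a)` tends both to `ω a` and
    -- to `ω (α a)`.
    have h1 := (Filter.tendsto_add_atTop_iff_nat 1).2 (h a φ)
    have h2 := h (α a) φ
    simp only [Function.iterate_succ_apply] at h1
    simpa only [hω.map_one, one_mul] using tendsto_nhds_unique h2 h1

end SquareSummable

/-! ### The shift on the algebra and its orbits -/

theorem norm_conj {V : Type} [NormedAddCommGroup V] [InnerProductSpace ℂ V] [CompleteSpace V]
    (u : V ≃ₗᵢ[ℂ] V) (X : V →L[ℂ] V) : ‖u.conjStarAlgEquiv X‖ = ‖X‖ := by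
  have h : ∀ (v : V ≃ₗᵢ[ℂ] V) (X : V →L[ℂ] V), ‖v.conjStarAlgEquiv X‖ ≤ ‖X‖ := fun v X =>
    ContinuousLinearMap.opNorm_le_bound _ (norm_nonneg _) fun x => by
      rw [LinearIsometryEquiv.conjStarAlgEquiv_apply_apply, LinearIsometryEquiv.norm_map]
      simpa using X.le_opNorm (v.symm x)
  refine (h u X).antisymm ?_
  have h1 := h u.symm (u.conjStarAlgEquiv X)
  have h2 : u.symm.conjStarAlgEquiv (u.conjStarAlgEquiv X) = X :=
    u.conjStarAlgEquiv.symm_apply_apply X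
  rwa [h2] at h1

section FockAlgebra

variable (hT : IsYangBaxterHecke T) (hM : BddAbove (Set.range fun n => ‖R T n‖))

theorem annihilation_mem (j : ℤ) :
    annihilation hT hM (basisVec j) ∈ fockAlgebra hT hM :=
  subset_closure (StarAlgebra.subset_adjoin ℂ _ ⟨j, rfl⟩)

theorem star_annihilation (f : L2 ℤ) :
    star (annihilation hT hM f) = creation hT hM f :=
  ContinuousLinearMap.adjoint_adjoint _

theorem creation_mem (j : ℤ) : creation hT hM (basisVec j) ∈ fockAlgebra hT hM := by
  rw [← star_annihilation]
  exact star_mem (annihilation_mem hT hM j)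

/-- The annihilator `a_j` as an element of the C⋆-algebra generated by the annihilators. -/
def annihilator (j : ℤ) : fockAlgebra hT hM := ⟨_, annihilation_mem hT hM j⟩

/-- The creator `a_j†` as an element of the C⋆-algebra generated by the annihilators. -/
def creator (j : ℤ) : fockAlgebra hT hM := ⟨_, creation_mem hT hM j⟩

theorem star_creator (j : ℤ) : star (creator hT hM j) = annihilator hT hM j := rfl

theorem star_annihilator (j : ℤ) : star (annihilator hT hM j) = creator hT hM j :=
  Subtype.ext (star_annihilation hT hM _)

theorem shiftAut_creator (hU : Commute T (shiftOp 2)) (j : ℤ) :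
    shiftAut hT hU hM (creator hT hM j) = creator hT hM (j + 1) := by
  have h : shiftAut hT hU hM (annihilator hT hM j) = annihilator hT hM (j + 1) :=
    Subtype.ext (conj_annihilation hT hU hM j)
  have h1 := (shiftAut hT hU hM).map_star' (annihilator hT hM j)
  rw [star_annihilator] at h1
  refine h1.trans ?_
  rw [← star_annihilator]
  exact congrArg star h

theorem shiftAut_iterate_creator (hU : Commute T (shiftOp 2)) (j : ℤ) (n : ℕ) :
    (shiftAut hT hU hM)^[n] (creator hT hM j) = creator hT hM (j + n) := by
  induction n with
  | zero => simp
  | succ n ih =>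
    rw [Function.iterate_succ_apply', ih, shiftAut_creator]
    congr 1
    push_cast
    ring

theorem norm_shiftAut_iterate (hU : Commute T (shiftOp 2)) (n : ℕ) (X : fockAlgebra hT hM) :
    ‖(shiftAut hT hU hM)^[n] X‖ = ‖X‖ := by
  have h : ∀ X, ‖shiftAut hT hU hM X‖ = ‖X‖ := fun X =>
    norm_conj (fockShift hT hU) X.1
  induction n with
  | zero => rfl
  | succ n ih => rw [Function.iterate_succ_apply', h, ih]

theorem norm_sum_creation_mul_le {M K : ℝ} (hR : ∀ n, ‖R T n‖ ≤ M) (j : ℤ)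
    (B : ℕ → FockSpace hT →L[ℂ] FockSpace hT) (hB : ∀ n, ‖B n‖ ≤ K) (N : ℕ) (c : ℕ → ℂ) :
    ‖∑ n ∈ Finset.range N, c n • (creation hT hM (basisVec (j + n)) * B n)‖ ^ 2
      ≤ M * K ^ 2 * ∑ n ∈ Finset.range N, ‖c n‖ ^ 2 := by
  have hM0 : 0 ≤ M := (norm_nonneg _).trans (hR 0)
  have hK0 : 0 ≤ K := (norm_nonneg _).trans (hB 0)
  set S := ∑ n ∈ Finset.range N, ‖c n‖ ^ 2 with hS
  have hS0 : 0 ≤ S := Finset.sum_nonneg fun _ _ => by positivity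
  suffices key : ‖∑ n ∈ Finset.range N, c n • (creation hT hM (basisVec (j + n)) * B n)‖
      ≤ √(M * K ^ 2 * S) by
    calc _ ≤ √(M * K ^ 2 * S) ^ 2 := by gcongr
      _ = _ := Real.sq_sqrt (by positivity)
  refine ContinuousLinearMap.opNorm_le_bound _ (Real.sqrt_nonneg _) fun ξ => ?_
  refine le_of_sq_le_sq ?_ (by positivity)
  rw [mul_pow, Real.sq_sqrt (by positivity)]
  -- The row estimate is indexed by integers `s = j + n`; `n` is recovered as `(s - j).toNat`.
  let shiftEmb : ℕ ↪ ℤ := ⟨fun n => j + n, fun a b h => by simpa using h⟩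
  have hback : ∀ n, (shiftEmb n - j).toNat = n := fun n => by
    change (j + (n : ℤ) - j).toNat = n
    omega
  have h := norm_sum_creation_le hT hM hR ((Finset.range N).map shiftEmb)
    fun s => c (s - j).toNat • B (s - j).toNat ξ
  simp only [Finset.sum_map, hback] at h
  refine le_of_eq_of_le ?_ (h.trans ?_)
  · rw [sum_apply]
    congr 2
    refine Finset.sum_congr rfl fun n _ => ?_
    rw [map_smul]
    rfl
  · have hb : ∀ n, ‖c n • B n ξ‖ ^ 2 ≤ ‖c n‖ ^ 2 * (K ^ 2 * ‖ξ‖ ^ 2) := by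
      intro n
      rw [norm_smul, mul_pow, ← mul_pow K]
      gcongr
      exact (B n).le_of_opNorm_le (hB n) ξ
    calc M * ∑ n ∈ Finset.range N, ‖c n • B n ξ‖ ^ 2
        ≤ M * ∑ n ∈ Finset.range N, ‖c n‖ ^ 2 * (K ^ 2 * ‖ξ‖ ^ 2) := by
          gcongr with n
          exact hb n
      _ = _ := by rw [← Finset.sum_mul, ← hS]; ring

/-- The `n`-th iterate is `a_{j+n}†` times an operator of norm `‖Y‖`, so the row estimate applies
with constant `M ‖Y‖²`. -/
theorem creator_mul_squareBounded (hU : Commute T (shiftOp 2)) (j : ℤ) (Y : fockAlgebra hT hM) :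
    HasSquareBoundedOrbit (shiftAut hT hU hM) (creator hT hM j * Y) := by
  obtain ⟨M, hR⟩ := id hM
  refine ⟨M * ‖Y‖ ^ 2, fun N c => ?_⟩
  have h := norm_sum_creation_mul_le hT hM (fun n => hR ⟨n, rfl⟩) j
    (fun n => ((shiftAut hT hU hM)^[n] Y).1)
    (fun n => (norm_shiftAut_iterate hT hM hU n Y).le) N c
  refine le_of_eq_of_le ?_ h
  congr 1
  refine (congrArg norm ((map_sum (fockAlgebra hT hM).subtype _ _).trans
    (Finset.sum_congr rfl fun n _ => ?_)) :)
  rw [iterate_map_mul, shiftAut_iterate_creator]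
  rfl

/-! ### The vacuum state and convergence on words -/

/-- The range of a creator has no component in degree zero, hence is orthogonal to `Ω`. -/
theorem vacuumState_creator_mul (j : ℤ) (Y : fockAlgebra hT hM) :
    vacuumState hT hM (creator hT hM j * Y) = 0 := by
  change ⟪vacuum hT, creation hT hM (basisVec j) ((Y : FockSpace hT →L[ℂ] FockSpace hT) _)⟫_ℂ = 0
  rw [vacuum, toFock, lp.inner_single_left, creation, raise_apply_zero, inner_zero_right]

theorem vacuumState_mul_annihilator (j : ℤ) (Y : fockAlgebra hT hM) :
    vacuumState hT hM (Y * annihilator hT hM j) = 0 := by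
  change ⟪vacuum hT, (Y : FockSpace hT →L[ℂ] FockSpace hT)
    (annihilation hT hM (basisVec j) (vacuum hT))⟫_ℂ = 0
  rw [vacuum, annihilation_toFock_zero, map_zero, inner_zero_right]

theorem norm_vacuum : ‖vacuum hT‖ = 1 := by
  refine (sq_eq_sq₀ (norm_nonneg _) zero_le_one).1 ?_
  rw [vacuum, toFock, lp.norm_single (by norm_num), UniformSpace.Completion.norm_coe,
    deformed_norm_sq]
  change (⟪_, (1 : Op 0) _⟫_ℂ).re = _
  rw [one_apply_eq_self, lp.inner_single_left]
  simp

open scoped ComplexOrder in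
theorem vacuumState_isState : IsState (vacuumState hT hM) where
  nonneg X := by
    have h : vacuumState hT hM (star X * X)
        = ⟪(X : FockSpace hT →L[ℂ] FockSpace hT) (vacuum hT),
          (X : FockSpace hT →L[ℂ] FockSpace hT) (vacuum hT)⟫_ℂ :=
      ContinuousLinearMap.adjoint_inner_right (X : FockSpace hT →L[ℂ] FockSpace hT) (vacuum hT) _
    rw [h, inner_self_eq_norm_sq_to_K]
    refine (Complex.zero_le_real.2
      (sq_nonneg ‖(X : FockSpace hT →L[ℂ] FockSpace hT) (vacuum hT)‖)).trans_eq ?_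
    push_cast
    rfl
  map_one := by
    change ⟪vacuum hT, vacuum hT⟫_ℂ = 1
    rw [inner_self_eq_norm_sq_to_K, norm_vacuum]
    simp

open scoped Pointwise in
theorem adjoin_le_span_normalOrdered
    (hfin : ∀ i j : ℤ, {p : ℤ × ℤ | coeff T j p.2 i p.1 ≠ 0}.Finite) :
    (StarAlgebra.adjoin ℂ (Set.range (annihilator hT hM)) : Set (fockAlgebra hT hM))
      ⊆ Submodule.span ℂ ((Submonoid.closure (Set.range (creator hT hM)) : Set (fockAlgebra hT hM))
        * (Submonoid.closure (Set.range (annihilator hT hM)) : Set (fockAlgebra hT hM))) := by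
  have hstar : star (Set.range (annihilator hT hM)) = Set.range (creator hT hM) := by
    rw [← Set.image_star, ← Set.range_comp]
    exact congrArg Set.range (funext fun j => star_annihilator hT hM j)
  intro X hX
  have h : X ∈ Subalgebra.toSubmodule
    (StarAlgebra.adjoin ℂ (Set.range (annihilator hT hM))).toSubalgebra := hX
  rw [StarAlgebra.adjoin_eq_span, hstar] at h
  refine Submodule.span_le.2 (closure_subset_span_normalOrdered _ _ fun i j => ?_) h
  have hcomm : annihilator hT hM i * creator hT hM j
      = (if i = j then 1 else 0) + ∑ p ∈ (hfin i j).toFinset, coeff T j p.2 i p.1 •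
        (creator hT hM p.1 * annihilator hT hM p.2) := by
    apply Subtype.ext
    have := annihilation_mul_creation hT hfin hM i j
    refine this.trans ?_
    refine Eq.trans ?_ (AddMemClass.coe_add (fockAlgebra hT hM) _ _).symm
    congr 1
    · split_ifs <;> rfl
    · exact (map_sum (fockAlgebra hT hM).subtype (fun p : ℤ × ℤ => coeff T j p.2 i p.1 •
        (creator hT hM p.1 * annihilator hT hM p.2)) (hfin i j).toFinset).symm
  rw [hcomm]
  refine add_mem ?_ (sum_mem fun p _ => Submodule.smul_mem _ _ (Submodule.subset_span ?_))
  · split_ifs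
    · exact Submodule.subset_span (Or.inl rfl)
    · exact zero_mem _
  · exact Or.inr ⟨_, _, rfl⟩

/-- The inclusion into all bounded operators maps this `*`-algebra onto the one whose norm closure
defines `fockAlgebra`. -/
theorem dense_adjoin_annihilator :
    Dense (StarAlgebra.adjoin ℂ (Set.range (annihilator hT hM)) : Set (fockAlgebra hT hM)) := by
  intro X
  rw [closure_subtype]
  refine closure_mono ?_ X.2
  have h := StarAlgHom.map_adjoin (R := ℂ) (fockAlgebra hT hM).subtype
    (Set.range (annihilator hT hM))
  rw [← Set.range_comp] at h
  exact (SetLike.coe_injective.eq_iff.2 h).ge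

open scoped Pointwise in
theorem tendsto_normalOrdered (hU : Commute T (shiftOp 2)) {X : fockAlgebra hT hM}
    (hX : X ∈ Submodule.span ℂ
      ((Submonoid.closure (Set.range (creator hT hM)) : Set (fockAlgebra hT hM))
        * (Submonoid.closure (Set.range (annihilator hT hM)) : Set (fockAlgebra hT hM))))
    (f : fockAlgebra hT hM →L[ℂ] ℂ) :
    Filter.Tendsto (fun n : ℕ => f ((shiftAut hT hU hM)^[n] X)) Filter.atTop
      (nhds (f 1 * vacuumState hT hM X)) := by
  induction hX using Submodule.span_induction with
  | mem X hX =>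
    obtain ⟨u, hu, v, hv, rfl⟩ := hX
    -- A nontrivial word is handled through its outermost letter alone: the leftmost creator if
    -- there is one, otherwise the rightmost annihilator.
    have hu' : u = 1 ∨ ∃ j Y, u = creator hT hM j * Y := by
      induction hu using Submonoid.closure_induction_left with
      | one => exact Or.inl rfl
      | mul_left x hx y _ _ =>
        obtain ⟨j, rfl⟩ := hx
        exact Or.inr ⟨j, y, rfl⟩
    have hv' : v = 1 ∨ ∃ j Y, v = Y * annihilator hT hM j := by
      induction hv using Submonoid.closure_induction_right with
      | one => exact Or.inl rfl
      | mul_right x _ y hy _ =>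
        obtain ⟨j, rfl⟩ := hy
        exact Or.inr ⟨j, x, rfl⟩
    rcases hu' with rfl | ⟨j, Y, rfl⟩
    · rcases hv' with rfl | ⟨j, Y, rfl⟩
      · have h1 : ∀ n : ℕ, (shiftAut hT hU hM)^[n] (1 * 1) = 1 := fun n => by
          rw [mul_one]
          exact Function.iterate_fixed (map_one _) n
        simp only [h1]
        rw [mul_one, (vacuumState_isState hT hM).map_one, mul_one]
        exact tendsto_const_nhds
      · simp only [one_mul]
        rw [vacuumState_mul_annihilator, mul_zero]
        -- `Y a_j` is the adjoint of `a_j† Y*`.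
        have h := (creator_mul_squareBounded hT hM hU j (star Y)).star
        rw [star_mul, star_star, star_creator] at h
        exact h.tendsto f
    · simp only [mul_assoc]
      rw [vacuumState_creator_mul, mul_zero]
      exact (creator_mul_squareBounded hT hM hU j _).tendsto f
  | zero =>
    have h1 : ∀ n : ℕ, (shiftAut hT hU hM)^[n] 0 = 0 := fun n =>
      Function.iterate_fixed (map_zero _) n
    simp [h1]
  | add X Y _ _ hX hY =>
    simp only [iterate_map_add, map_add, mul_add]
    exact hX.add hY
  | smul c X _ hX =>
    have h1 : ∀ n : ℕ, (shiftAut hT hU hM)^[n] (c • X) = c • (shiftAut hT hU hM)^[n] X :=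
      fun n => (Function.Semiconj.iterate_right (f := (c • ·))
        (fun x => (map_smul (shiftAut hT hU hM) c x).symm) n X).symm
    simp only [h1, map_smul, smul_eq_mul]
    rw [mul_left_comm]
    exact hX.const_mul c

end FockAlgebra

end DeformedFock

end

theorem theorem4p3 (T : DeformedFock.Op 2) (hT : DeformedFock.IsYangBaxterHecke T)
    (hU : Commute T (DeformedFock.shiftOp 2))
    (hfin : ∀ i j : ℤ, {p : ℤ × ℤ | DeformedFock.coeff T j p.2 i p.1 ≠ 0}.Finite)
    (hM : BddAbove (Set.range fun n => ‖DeformedFock.R T n‖)) :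
    DeformedFock.IsUniquelyMixing (DeformedFock.shiftAut hT hU hM)
        (DeformedFock.vacuumState hT hM) ∧
      {φ : DeformedFock.fockAlgebra hT hM →L[ℂ] ℂ | DeformedFock.IsState φ ∧
          ∀ X, φ (DeformedFock.shiftAut hT hU hM X) = φ X} = {DeformedFock.vacuumState hT hM} := by
  have h : DeformedFock.IsUniquelyMixing (DeformedFock.shiftAut hT hU hM)
      (DeformedFock.vacuumState hT hM) :=
    ⟨DeformedFock.vacuumState_isState hT hM, fun X f =>
      DeformedFock.tendsto_of_mem_closure
        (fun n Y => (DeformedFock.norm_shiftAut_iterate hT hM hU n Y).le) f _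
        (fun Y hY => DeformedFock.tendsto_normalOrdered hT hM hU
          (DeformedFock.adjoin_le_span_normalOrdered hT hM hfin hY) f)
        (DeformedFock.dense_adjoin_annihilator hT hM X)⟩
  exact ⟨h, h.invariant_eq⟩
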